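/- Let $m\ge 0$ be an integer. For $\tau\in\mathbb C$ with $\operatorname{Im}\tau>0$ write $q^{x}=e^{2\pi i\tau x}$. For an integer $k\ge 1$ and $j\in\mathbb Z/2k\mathbb Z$ put $$\Theta_{j,k}(\tau,z)=\sum_{n\in\mathbb Z+\frac{j}{2k}}q^{kn^2}e^{2\pi i knz},$$ $$R_{k;j}(\tau,v)=\sum_{\substack{n\in\mathbb Z\\ n\equiv j \bmod 2k}}\left(\operatorname{sign}\left(n+\tfrac12\right)-E\left(\left(n+2k\tfrac{\operatorname{Im}v}{\operatorname{Im}\tau}\right)\left(\tfrac{\operatorname{Im}\tau}{k}\right)^{1/2}\right)\right)e^{-\frac{\pi i n^2}{2k}\tau-2\pi i nv},$$ where $E(x)=2\int_0^x e^{-\pi s^2}\,ds$. For $z_1,z_2,t\in\mathbb C$ with $z_1,z_2\notin\mathbb Z+\mathbb Z\tau$ put $$\Phi^{[m]}(\tau,z_1,z_2,t)=e^{2\pi i(m+1)t}\sum_{j\in\mathbb Z}\left(\frac{e^{2\pi ij(m+1)(z_1+z_2)}q^{j^2(m+1)}}{1-e^{2\pi iz_1}q^j}-\frac{e^{-2\pi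 ij(m+1)(z_1+z_2)}q^{j^2(m+1)}}{1-e^{-2\pi iz_2}q^j}\right),$$ $$\Phi^{[m]}_{\mathrm{add}}(\tau,z_1,z_2,t)=-\tfrac12e^{2\pi i(m+1)t}\sum_{j\in\mathbb Z/(2m+2)\mathbb Z}R_{m+1;j}\left(\tau,\tfrac{z_1-z_2}{2}\right)\left(\Theta_{j,m+1}-\Theta_{-j,m+1}\right)(\tau,z_1+z_2),$$ and $\tilde\Phi^{[m]}=\Phi^{[m]}+\Phi^{[m]}_{\mathrm{add}}$. For $u,v,t\in\mathbb C$ with $v-u,\,-u-v\notin\mathbb Z+\mathbb Z\tau$ put $\varphi^{[m]}(\tau,u,v,t)=\Phi^{[m]}(\tau,v-u,-u-v,t)$, $$\varphi^{[m]}_{\mathrm{add}}(\tau,u,v,t)=\tfrac12e^{2\pi i(m+1)t}\sum_{j\in\mathbb Z/(2m+2)\mathbb Z}R_{m+1;j}(\tau,v)\left(\Theta_{j,m+1}-\Theta_{-j,m+1}\right)(\tau,2u),$$ and $\tilde\varphi^{[m]}=\varphi^{[m]}+\varphi^{[m]}_{\mathrm{add}}$. All the series above converge absolutely. **Theorem.**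 Let $\operatorname{Im}\tau>0$ and $u,v,t\in\mathbb C$ with $v-u,\,-u-v\notin\mathbb Z+\mathbb Z\tau$. Then: (a) $\tilde\varphi^{[m]}\left(-\frac1\tau,\frac u\tau,\frac v\tau,t-\frac{u^2-v^2}{\tau}\right)=\tau\,\tilde\varphi^{[m]}(\tau,u,v,t)$. (b) $\tilde\varphi^{[m]}(\tau,u+a,v+b,t)=\tilde\varphi^{[m]}(\tau,u,v,t)$ if $a,b\in\frac12\mathbb Z$ are such that $a+b\in\mathbb Z$. (c) $\tilde\varphi^{[m]}(\tau,u,-v,t)=\tilde\varphi^{[m]}(\tau,u,v,t)$ and $\tilde\varphi^{[m]}(\tau,-u,v,t)=-\tilde\varphi^{[m]}(\tau,u,v,t)$. (d) $\tilde\varphi^{[m]}(\tau+1,u,v,t)=\tilde\varphi^{[m]}(\tau,u,v,t)$. (e) $\tilde\varphi^{[m]}(\tau,u+a\tau,v+b\tau,t)=q^{(m+1)(b^2-a^2)}e^{4\pi i(m+1)(-au+bv)}\,\tilde\varphi^{[m]}(\tau,u,v,t)$ if $a,b\in\frac12\mathbb Z$ are such that $a+b\in\mathbb Z$. **Corollary.**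 Let $\operatorname{Im}\tau>0$ and $z_1,z_2,t\in\mathbb C$ with $z_1,z_2\notin\mathbb Z+\mathbb Z\tau$. Then $\tilde\Phi^{[m]}(\tau,z_1,z_2,t)=\tilde\varphi^{[m]}\left(\tau,-\frac{z_1+z_2}{2},\frac{z_1-z_2}{2},t\right)$, and: (a) $\tilde\Phi^{[m]}\left(-\frac1\tau,\frac{z_1}\tau,\frac{z_2}\tau,t-\frac{z_1z_2}{\tau}\right)=\tau\,\tilde\Phi^{[m]}(\tau,z_1,z_2,t)$. (b) $\tilde\Phi^{[m]}(\tau,z_1+a,z_2+b,t)=\tilde\Phi^{[m]}(\tau,z_1,z_2,t)$ if $a,b\in\mathbb Z$. (c) $\tilde\Phi^{[m]}(\tau,-z_1,-z_2,t)=-\tilde\Phi^{[m]}(\tau,z_1,z_2,t)$ and $\tilde\Phi^{[m]}(\tau,z_2,z_1,t)=\tilde\Phi^{[m]}(\tau,z_1,z_2,t)$. (d) $\tilde\Phi^{[m]}(\tau+1,z_1,z_2,t)=\tilde\Phi^{[m]}(\tau,z_1,z_2,t)$. (e) $\tilde\Phi^{[m]}(\tau,z_1+j\tau,z_2+k\tau,t)=q^{-(m+1)jk}e^{-2\pi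 i(m+1)(kz_1+jz_2)}\,\tilde\Phi^{[m]}(\tau,z_1,z_2,t)$ if $j,k\in\mathbb Z$. -/

import Mathlib

noncomputable section

namespace ModifiedNumerator

/-- `q ^ x` for `q = e^{2πiτ}`, with the branch fixed by `τ`. -/
def qPow (τ x : ℂ) : ℂ := Complex.exp (2 * Real.pi * Complex.I * τ * x)

/-- `e^{2πi x}`. -/
def e (x : ℂ) : ℂ := Complex.exp (2 * Real.pi * Complex.I * x)

/-- The general term of `Θ_{j,k}(τ, z) = ∑_{n ∈ ℤ + j/(2k)} q^{k n²} e^{2πi k n z}`,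
where `n` is replaced by `n + j/(2k)` with `n ∈ ℤ`. -/
def thetaTerm (j : ℤ) (k : ℕ) (τ z : ℂ) (n : ℤ) : ℂ :=
  qPow τ (k * ((n : ℂ) + j / (2 * k)) ^ 2) * e (k * ((n : ℂ) + j / (2 * k)) * z)

/-- The theta function `Θ_{j,k}(τ, z)` of degree `k`. -/
def Theta (j : ℤ) (k : ℕ) (τ z : ℂ) : ℂ := ∑' n : ℤ, thetaTerm j k τ z n

/-- The odd function `E(x) = 2 ∫₀ˣ e^{-π u²} du`, at real arguments. -/
def E (x : ℝ) : ℝ := 2 * ∫ u in (0 : ℝ)..x, Real.exp (-Real.pi * u ^ 2)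

/-- The term with index `n` of the series for Zwegers' function `R_{m;j}(τ, v)`. -/
def zwegersTerm (m : ℕ) (τ v : ℂ) (n : ℤ) : ℂ :=
  ((Real.sign ((n : ℝ) + 1 / 2) -
      E (((n : ℝ) + 2 * m * (v.im / τ.im)) * Real.sqrt (τ.im / m)) : ℝ) : ℂ) *
    Complex.exp (-(Real.pi * Complex.I * (n : ℂ) ^ 2 / (2 * m)) * τ -
      2 * Real.pi * Complex.I * n * v)

/-- Zwegers' function `R_{m;j}(τ, v)`: the sum over the integers `n ≡ j mod 2m`. -/
def zwegersR (m : ℕ) (j : ℤ) (τ v : ℂ) : ℂ :=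
  ∑' n : {n : ℤ // n ≡ j [ZMOD 2 * m]}, zwegersTerm m τ v n

/-- The general term of the series for `Φ^{[m]}`, without the factor `e^{2πi(m+1)t}`. -/
def numeratorTerm (m : ℕ) (τ z₁ z₂ : ℂ) (j : ℤ) : ℂ :=
  e (j * (m + 1) * (z₁ + z₂)) * qPow τ ((j : ℂ) ^ 2 * (m + 1)) / (1 - e z₁ * qPow τ j) -
    e (-(j * (m + 1) * (z₁ + z₂))) * qPow τ ((j : ℂ) ^ 2 * (m + 1)) / (1 - e (-z₂) * qPow τ j)

/-- The numerator `Φ^{[m]}(τ, z₁, z₂, t)`. -/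
def Phi (m : ℕ) (τ z₁ z₂ t : ℂ) : ℂ :=
  e ((m + 1) * t) * ∑' j : ℤ, numeratorTerm m τ z₁ z₂ j

/-- The numerator `φ^{[m]}(τ, u, v, t)` in the coordinates `u = -(z₁ + z₂)/2`,
`v = (z₁ - z₂)/2`, that is, `z₁ = v - u`, `z₂ = -u - v`. -/
def phi (m : ℕ) (τ u v t : ℂ) : ℂ := Phi m τ (v - u) (-u - v) t

/-- `Θ_{j,k}(τ, z)` depends on `j` modulo `2k` only. -/
theorem Theta_add_two_mul (j : ℤ) (k : ℕ) (hk : k ≠ 0) (τ z : ℂ) :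
    Theta (j + 2 * k) k τ z = Theta j k τ z := by
  have hk' : (k : ℂ) ≠ 0 := Nat.cast_ne_zero.mpr hk
  unfold Theta
  rw [← (Equiv.addRight (1 : ℤ)).tsum_eq (thetaTerm j k τ z)]
  refine tsum_congr fun n => ?_
  have h : (n : ℂ) + ((j + 2 * k : ℤ) : ℂ) / (2 * k) = ((n + 1 : ℤ) : ℂ) + j / (2 * k) := by
    push_cast
    field_simp
    ring
  simp only [thetaTerm, Equiv.coe_addRight, h]

/-- `R_{m;j}(τ, v)` depends on `j` modulo `2m` only. -/
theorem zwegersR_add_two_mul (m : ℕ) (j : ℤ) (τ v : ℂ) :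
    zwegersR m (j + 2 * m) τ v = zwegersR m j τ v := by
  have h : (fun n : ℤ => n ≡ j + 2 * m [ZMOD 2 * m]) = fun n : ℤ => n ≡ j [ZMOD 2 * m] := by
    funext n
    simp [Int.ModEq]
  exact congrArg (fun p : ℤ → Prop => ∑' n : {n : ℤ // p n}, zwegersTerm m τ v n) h

/-- The correction `φ^{[m]}_add(τ, u, v, t)`; the sum over `ℤ/(2m+2)ℤ` is taken over the
representatives `0, …, 2m+1`. -/
def phiAdd (m : ℕ) (τ u v t : ℂ) : ℂ :=
  1 / 2 * e ((m + 1) * t) * ∑ j ∈ Finset.range (2 * m + 2),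
    zwegersR (m + 1) j τ v * (Theta j (m + 1) τ (2 * u) - Theta (-j) (m + 1) τ (2 * u))

/-- The modified numerator `φ̃^{[m]}(τ, u, v, t)`. -/
def phiTilde (m : ℕ) (τ u v t : ℂ) : ℂ := phi m τ u v t + phiAdd m τ u v t

/-- The correction `Φ^{[m]}_add(τ, z₁, z₂, t)`. -/
def PhiAdd (m : ℕ) (τ z₁ z₂ t : ℂ) : ℂ :=
  -(1 / 2) * e ((m + 1) * t) * ∑ j ∈ Finset.range (2 * m + 2),
    zwegersR (m + 1) j τ ((z₁ - z₂) / 2) *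
      (Theta j (m + 1) τ (z₁ + z₂) - Theta (-j) (m + 1) τ (z₁ + z₂))

/-- The modified numerator `Φ̃^{[m]}(τ, z₁, z₂, t)`. -/
def PhiTilde (m : ℕ) (τ z₁ z₂ t : ℂ) : ℂ := Phi m τ z₁ z₂ t + PhiAdd m τ z₁ z₂ t

/-- The points off the polar divisor of `Φ^{[m]}`: neither `z₁` nor `z₂` lies in `ℤ + ℤτ`. -/
def IsRegular (τ z₁ z₂ : ℂ) : Prop :=
  ∀ j k : ℤ, z₁ ≠ j + k * τ ∧ z₂ ≠ j + k * τ

/-- `a, b ∈ ½ℤ` and `a + b ∈ ℤ`. -/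
def IsHalfIntegralPair (a b : ℝ) : Prop :=
  (∃ k : ℤ, a = k / 2) ∧ (∃ l : ℤ, b = l / 2) ∧ ∃ n : ℤ, a + b = n

end ModifiedNumerator

end

noncomputable section

namespace ModifiedNumerator

open Complex Filter Topology
open scoped ComplexConjugate Real

/-! ### The exponential `e` -/

/-! Put M = m + 1. Everything reduces to one function of two variables, the modified Appell function
Ã(u, v) = A(u, v) - ½ ∑_j R_{M;j}(v) Θ_{j,M}(2u), where A(u, v) = ∑_n q^{M n²} e^{4πi M n u} / (1 -
e^{2πi(u - v)} q^n). Expanding the numerator and using 1/(1 - X⁻¹) = 1 - 1/(1 - X) gives φ̃ = e^{2πi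
M t} (Ã(-u, v) - Ã(u, v)) (`phiTilde_eq`); oddness in u is then immediate, and every other claim
follows from a transformation law of Ã.

The elliptic laws, the reflection Ã(-u, -v) = -Ã(u, v) and the law under τ ↦ τ + 1 come from
comparing series term by term. A alone fails them by finitely many theta functions: the shift of (u,
v) by (τ/2, τ/2) leaves a truncated geometric series, and the reflection leaves Θ_{0,M}. The same
terms appear in the correction, where sign(n + 1/2) changes at finitely many n, and they cancel
(`appellMod_add_half`, `appellMod_neg_neg`).

The inversion τ ↦ -1/τ is proved without evaluating any Mordell integral. Fix u and let D(v) be the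
difference of the two sides (`inversionDefect`). The derivative ∂R_{M;j}/∂v̄ is an explicit factor
times the conjugate of Θ_{j,M}(2v), so ∂Ã/∂v̄ involves only the kernel ∑_j conj Θ_{j,M}(2v)
Θ_{j,M}(2u). The theta functions transform under inversion by a multiple of a unitary finite Fourier
matrix, so this kernel is covariant and ∂D/∂v̄ = 0. The residues at v = u cancel, and the elliptic
laws give D(v + 1) = D(v) and D(v + τ) = e^{2πi M(2v + τ)} D(v). Such a function extends to a
bounded entire function, hence is constant by Liouville, and the nonconstant multiplier forces it to
be 0 (`eq_zero_of_negative_index`). -/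

theorem e_add (x y : ℂ) : e (x + y) = e x * e y := by
  simp only [e, mul_add, Complex.exp_add]

theorem e_zero : e 0 = 1 := by simp [e]

theorem e_neg (x : ℂ) : e (-x) = (e x)⁻¹ := by
  simp only [e, mul_neg, Complex.exp_neg]

theorem e_ne_zero (x : ℂ) : e x ≠ 0 := Complex.exp_ne_zero _

theorem e_int (n : ℤ) : e n = 1 := by
  rw [e, Complex.exp_eq_one_iff]
  exact ⟨n, by ring⟩

theorem e_add_int (x : ℂ) (n : ℤ) : e (x + n) = e x := by
  rw [e_add, e_int, mul_one]

/-- `e x = e y` as soon as `x - y` is an integer. -/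
theorem e_congr {x y : ℂ} (n : ℤ) (h : x = y + n) : e x = e y := by
  rw [h, e_add_int]

theorem e_eq_one_iff {x : ℂ} : e x = 1 ↔ ∃ n : ℤ, x = n := by
  rw [e, Complex.exp_eq_one_iff]
  refine exists_congr fun n => ?_
  rw [mul_comm (n : ℂ)]
  exact mul_right_inj' Complex.two_pi_I_ne_zero

theorem e_nat_mul (k : ℕ) (x : ℂ) : e (k * x) = e x ^ k := by
  rw [e, e, ← Complex.exp_nat_mul]
  congr 1
  ring

theorem qPow_eq_e (τ x : ℂ) : qPow τ x = e (τ * x) := by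
  simp only [qPow, e, mul_assoc]

theorem norm_e (x : ℂ) : ‖e x‖ = Real.exp (-2 * π * x.im) := by
  rw [e, Complex.norm_exp]
  congr 1
  simp

theorem conj_e (x : ℂ) : conj (e x) = e (-conj x) := by
  rw [e, e, ← Complex.exp_conj]
  congr 1
  simp only [map_mul, Complex.conj_ofReal, Complex.conj_I, Complex.conj_ofNat]
  ring

theorem hasDerivAt_e (x : ℂ) : HasDerivAt e (2 * π * I * e x) x := by
  have h : HasDerivAt (fun y : ℂ => 2 * π * I * y) (2 * π * I) x := by
    simpa using (hasDerivAt_id x).const_mul (2 * π * I : ℂ)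
  rw [mul_comm]
  exact h.cexp

theorem differentiable_e : Differentiable ℂ e := fun x => (hasDerivAt_e x).differentiableAt

theorem continuous_e : Continuous e := differentiable_e.continuous

/-! ### Sums over residue classes -/

/-- The corrections sum over the representatives 0, …, N - 1; passing to `ZMod N` turns shifts and
negation of the index into permutations of a finite group. -/
theorem sum_range_periodic_eq_sum_zmod {N : ℕ} [NeZero N] {p : ℤ → ℂ}
    (hp : ∀ j, p (j + N) = p j) :
    ∃ P : ZMod N → ℂ, (∀ j : ℤ, p j = P j) ∧
      ∑ j ∈ Finset.range N, p j = ∑ x : ZMod N, P x := by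
  have hmod : ∀ j k : ℤ, p (j + N * k) = p j := by
    intro j k
    induction k using Int.induction_on with
    | zero => simp
    | succ i ih => rw [← ih, ← hp (j + N * i)]; congr 1; ring
    | pred i ih => rw [← ih, ← hp (j + N * (-(i : ℤ) - 1))]; congr 1; ring
  have hval : ∀ j : ℤ, p j = p ((j : ZMod N).val : ℤ) := by
    intro j
    rw [ZMod.val_intCast]
    conv_lhs => rw [← Int.emod_add_mul_ediv j N]
    exact hmod _ _
  refine ⟨fun x => p (x.val : ℤ), hval, ?_⟩
  refine Finset.sum_bij' (fun j _ => (j : ZMod N)) (fun x _ => x.val) ?_ ?_ ?_ ?_ ?_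
  · simp
  · intro x _
    exact Finset.mem_range.mpr (ZMod.val_lt x)
  · intro j hj
    exact ZMod.val_cast_of_lt (Finset.mem_range.mp hj)
  · intro x _
    simp
  · intro j hj
    rw [ZMod.val_cast_of_lt (Finset.mem_range.mp hj)]

theorem sum_range_periodic_add {N : ℕ} (hN : N ≠ 0) {p : ℤ → ℂ} (hp : ∀ j, p (j + N) = p j)
    (a : ℤ) : ∑ j ∈ Finset.range N, p (j + a) = ∑ j ∈ Finset.range N, p j := by
  have : NeZero N := ⟨hN⟩
  obtain ⟨P, hP, hs⟩ := sum_range_periodic_eq_sum_zmod hp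
  obtain ⟨Q, hQ, hs'⟩ := sum_range_periodic_eq_sum_zmod (N := N) (p := fun j => p (j + a))
    (fun j => by rw [← hp (j + a)]; congr 1; ring)
  rw [hs, hs', ← Equiv.sum_comp (Equiv.addRight (a : ZMod N)) P]
  refine Finset.sum_congr rfl fun x _ => ?_
  obtain ⟨j, rfl⟩ := ZMod.intCast_surjective x
  rw [← hQ, hP]
  simp

theorem sum_range_periodic_neg {N : ℕ} (hN : N ≠ 0) {p : ℤ → ℂ} (hp : ∀ j, p (j + N) = p j) :
    ∑ j ∈ Finset.range N, p (-j) = ∑ j ∈ Finset.range N, p j := by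
  have : NeZero N := ⟨hN⟩
  obtain ⟨P, hP, hs⟩ := sum_range_periodic_eq_sum_zmod hp
  obtain ⟨Q, hQ, hs'⟩ := sum_range_periodic_eq_sum_zmod (N := N) (p := fun j => p (-j))
    (fun j => by rw [← hp (-(j + N))]; congr 1; ring)
  rw [hs, hs', ← Equiv.sum_comp (Equiv.neg (ZMod N)) P]
  refine Finset.sum_congr rfl fun x _ => ?_
  obtain ⟨j, rfl⟩ := ZMod.intCast_surjective x
  rw [← hQ, hP]
  simp

theorem tsum_eq_sum_range_tsum {N : ℕ} (hN : N ≠ 0) {g : ℤ → ℂ} (hg : Summable g) :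
    ∑' n, g n = ∑ j ∈ Finset.range N, ∑' k : ℤ, g (j + N * k) := by
  have : NeZero N := ⟨hN⟩
  rw [← (Int.divModEquiv N).symm.tsum_eq g,
    Summable.tsum_prod (f := fun c => g ((Int.divModEquiv N).symm c))
      ((Int.divModEquiv N).symm.summable_iff.mpr hg), Finset.sum_range]
  have hs : Summable fun p : ℤ × Fin N => g (p.2.val + N * p.1) := by
    refine ((Int.divModEquiv N).symm.summable_iff.mpr hg).congr fun p => ?_
    simp only [Function.comp_apply, Int.divModEquiv_symm_apply]
    congr 1; ring
  have h' := Summable.tsum_finsetSum (s := (Finset.univ : Finset (Fin N)))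
    (f := fun (i : Fin N) (k : ℤ) => g (i.val + N * k))
    fun i _ => hs.comp_injective (i := fun k : ℤ => (k, i)) fun a b h => (Prod.ext_iff.mp h).1
  rw [← h']
  refine tsum_congr fun k => ?_
  rw [tsum_fintype]
  refine Finset.sum_congr rfl fun i _ => ?_
  simp only [Int.divModEquiv_symm_apply]
  congr 1; ring

/-- The residue class of `j` modulo `2M`, parametrised by the integers. -/
def residueEquiv (M : ℕ) (hM : M ≠ 0) (j : ℤ) : ℤ ≃ {n : ℤ // n ≡ j [ZMOD 2 * M]} where
  toFun k := ⟨j + (2 * M : ℕ) * k, by simp [Int.ModEq]⟩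
  invFun n := (n.1 - j) / (2 * M)
  left_inv k := by
    have : (2 * M : ℤ) ≠ 0 := by positivity
    simp only [Nat.cast_mul, Nat.cast_ofNat, add_sub_cancel_left]
    exact Int.mul_ediv_cancel_left k this
  right_inv n := by
    obtain ⟨n, hn⟩ := n
    ext
    simp only [Nat.cast_mul, Nat.cast_ofNat]
    rw [Int.mul_ediv_cancel' ((Int.modEq_iff_dvd.mp hn.symm))]
    ring

theorem zwegersR_eq_tsum {M : ℕ} (hM : M ≠ 0) (j : ℤ) (τ v : ℂ) :
    zwegersR M j τ v = ∑' k : ℤ, zwegersTerm M τ v (j + (2 * M : ℕ) * k) :=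
  ((residueEquiv M hM j).tsum_eq (fun n => zwegersTerm M τ v n)).symm

/-! ### The function `E` -/

theorem hasDerivAt_E (x : ℝ) : HasDerivAt E (2 * Real.exp (-π * x ^ 2)) x := by
  have hc : Continuous fun u : ℝ => Real.exp (-π * u ^ 2) := by fun_prop
  exact (intervalIntegral.integral_hasDerivAt_right (hc.intervalIntegrable _ _)
    (hc.stronglyMeasurableAtFilter _ _) hc.continuousAt).const_mul 2

theorem E_neg (x : ℝ) : E (-x) = -E x := by
  unfold E
  have := intervalIntegral.integral_comp_neg (a := 0) (b := x)
    (fun u : ℝ => Real.exp (-π * u ^ 2))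
  simp only [neg_sq, neg_zero] at this
  rw [this, intervalIntegral.integral_symm]
  ring

theorem one_sub_E_eq (x : ℝ) :
    1 - E x = 2 * ∫ s in Set.Ioi (0 : ℝ), Real.exp (-π * (s + x) ^ 2) := by
  have hi : MeasureTheory.Integrable fun u : ℝ => Real.exp (-π * u ^ 2) :=
    integrable_exp_neg_mul_sq Real.pi_pos
  have h1 : ∫ s in Set.Ioi (0 : ℝ), Real.exp (-π * (s + x) ^ 2) =
      ∫ s in Set.Ioi x, Real.exp (-π * s ^ 2) := by
    have := (MeasureTheory.measurePreserving_add_right MeasureTheory.volume x).setIntegral_preimage_emb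
      (measurableEmbedding_addRight x) (fun u : ℝ => Real.exp (-π * u ^ 2)) (Set.Ioi x)
    simpa using this
  have h2 := intervalIntegral.integral_interval_add_Ioi (a := 0) (b := x)
    hi.integrableOn hi.integrableOn
  rw [integral_gaussian_Ioi, div_self Real.pi_ne_zero, Real.sqrt_one] at h2
  rw [h1, E]
  linarith

theorem one_sub_E_nonneg (x : ℝ) : 0 ≤ 1 - E x := by
  rw [one_sub_E_eq]
  have : 0 ≤ ∫ s in Set.Ioi (0 : ℝ), Real.exp (-π * (s + x) ^ 2) :=
    MeasureTheory.integral_nonneg fun s => (Real.exp_pos _).le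
  linarith

/-- For s, x ≥ 0 one has (s + x)² ≥ s² + x², so the tail integral is at most e^{-πx²} times half the
Gaussian mass. -/
theorem one_sub_E_le {x : ℝ} (hx : 0 ≤ x) : 1 - E x ≤ Real.exp (-π * x ^ 2) := by
  have hi : MeasureTheory.Integrable fun u : ℝ => Real.exp (-π * u ^ 2) :=
    integrable_exp_neg_mul_sq Real.pi_pos
  have h : ∫ s in Set.Ioi (0 : ℝ), Real.exp (-π * (s + x) ^ 2) ≤
      ∫ s in Set.Ioi (0 : ℝ), Real.exp (-π * x ^ 2) * Real.exp (-π * s ^ 2) := by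
    refine MeasureTheory.setIntegral_mono_on (hi.comp_add_right x).integrableOn
      (hi.const_mul _).integrableOn measurableSet_Ioi fun s hs => ?_
    rw [← Real.exp_add, Real.exp_le_exp]
    have : 0 ≤ π * (s * x) := mul_nonneg Real.pi_pos.le (mul_nonneg (le_of_lt hs) hx)
    nlinarith
  rw [MeasureTheory.integral_const_mul, integral_gaussian_Ioi, div_self Real.pi_ne_zero,
    Real.sqrt_one] at h
  rw [one_sub_E_eq]
  linarith

theorem abs_E_le_one (x : ℝ) : |E x| ≤ 1 := by
  have h1 := one_sub_E_nonneg x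
  have h2 := one_sub_E_nonneg (-x)
  rw [E_neg] at h2
  exact abs_le.mpr ⟨by linarith, by linarith⟩

/-- The sign of `n + 1/2` is `1` for `n ≥ 0` and `-1` for `n < 0`. -/
theorem sign_add_half (n : ℤ) : Real.sign ((n : ℝ) + 1 / 2) = if 0 ≤ n then 1 else -1 := by
  split_ifs with h
  · have : (0 : ℝ) ≤ n := by exact_mod_cast h
    exact Real.sign_of_pos (by linarith)
  · have : (n : ℝ) ≤ -1 := by exact_mod_cast (by omega : n ≤ -1)
    exact Real.sign_of_neg (by linarith)

theorem gaussian_shift_le {n c s K : ℝ} (hc : |c| ≤ K) :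
    Real.exp (-π * ((n + c) * s) ^ 2) ≤ Real.exp (-π * (s ^ 2 * (n ^ 2 - 2 * K * |n|))) := by
  rw [Real.exp_le_exp, neg_mul, neg_mul, neg_le_neg_iff, mul_pow, mul_comm (_ ^ 2) (s ^ 2)]
  have h1 : -(K * |n|) ≤ n * c := by
    have : |n * c| ≤ |n| * K := by rw [abs_mul]; exact mul_le_mul_of_nonneg_left hc (abs_nonneg n)
    linarith [neg_abs_le (n * c)]
  have : n ^ 2 - 2 * K * |n| ≤ (n + c) ^ 2 := by nlinarith [sq_nonneg c]
  gcongr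

/-- If n² ≤ 2K|n|, the exponential is at least 1 and the trivial bound 2 suffices. Otherwise |n| ≥
K, so n + c does not have the sign opposite to n and the Gaussian tail bound applies. -/
theorem abs_sign_sub_E_le (n : ℤ) {c s K : ℝ} (hs : 0 ≤ s) (hc : |c| ≤ K) :
    |Real.sign ((n : ℝ) + 1 / 2) - E ((n + c) * s)| ≤
      2 * Real.exp (-π * (s ^ 2 * ((n : ℝ) ^ 2 - 2 * K * |(n : ℝ)|))) := by
  have hg := gaussian_shift_le (n := n) (s := s) hc
  have hK : 0 ≤ K := (abs_nonneg c).trans hc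
  have hE := abs_le.mp (abs_E_le_one ((n + c) * s))
  have hpos := Real.exp_pos (-π * (s ^ 2 * ((n : ℝ) ^ 2 - 2 * K * |(n : ℝ)|)))
  rw [sign_add_half]
  rcases le_or_gt ((n : ℝ) ^ 2 - 2 * K * |(n : ℝ)|) 0 with h | h
  · have h1 : 1 ≤ Real.exp (-π * (s ^ 2 * ((n : ℝ) ^ 2 - 2 * K * |(n : ℝ)|))) := by
      rw [Real.one_le_exp_iff]
      have : s ^ 2 * ((n : ℝ) ^ 2 - 2 * K * |(n : ℝ)|) ≤ 0 :=
        mul_nonpos_of_nonneg_of_nonpos (sq_nonneg s) h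
      nlinarith [Real.pi_pos]
    rw [abs_le]
    split_ifs <;> constructor <;> linarith
  · have hn : K ≤ |(n : ℝ)| := by
      by_contra! hlt
      rw [← sq_abs] at h
      nlinarith [abs_nonneg (n : ℝ)]
    have hc' := abs_le.mp hc
    split_ifs with h0
    · have h0' : (0 : ℝ) ≤ n := by exact_mod_cast h0
      rw [abs_of_nonneg h0'] at hn
      have hx : 0 ≤ ((n : ℝ) + c) * s := mul_nonneg (by linarith) hs
      rw [abs_of_nonneg (one_sub_E_nonneg _)]
      linarith [one_sub_E_le hx]
    · have h0' : (n : ℝ) < 0 := by exact_mod_cast (not_le.mp h0)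
      rw [abs_of_neg h0'] at hn
      have hx : 0 ≤ -(((n : ℝ) + c) * s) := by nlinarith
      have h1 := one_sub_E_le hx
      have h2 := one_sub_E_nonneg (-(((n : ℝ) + c) * s))
      rw [E_neg, neg_sq] at h1
      rw [E_neg] at h2
      rw [abs_le]
      constructor <;> linarith

/-! ### Convergence of the series for `R` -/

/-- The majorant of the series for `R` and its derivatives. -/
def majorant (M : ℕ) (y B : ℝ) (n : ℤ) : ℝ :=
  Real.exp (-π * (y / (2 * M) * (n : ℝ) ^ 2 - 2 * (3 * B) * |(n : ℝ)|))

theorem summable_pow_mul_majorant {M : ℕ} (hM : M ≠ 0) {y : ℝ} (hy : 0 < y) (B : ℝ) (k : ℕ) :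
    Summable fun n : ℤ => |(n : ℝ)| ^ k * majorant M y B n := by
  have hT : 0 < y / (2 * M) := by positivity
  simpa [majorant] using summable_pow_mul_jacobiTheta₂_term_bound (3 * B) hT k

/-- The exponential factor of `zwegersTerm`. -/
def zwegersExp (M : ℕ) (τ v : ℂ) (n : ℤ) : ℂ :=
  e (-((n : ℂ) ^ 2 / (4 * M)) * τ - n * v)

/-- The argument of `E` in `zwegersTerm`. -/
def zwegersArg (M : ℕ) (τ v : ℂ) (n : ℤ) : ℝ :=
  ((n : ℝ) + 2 * M * (v.im / τ.im)) * Real.sqrt (τ.im / M)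

theorem zwegersTerm_eq (M : ℕ) (τ v : ℂ) (n : ℤ) :
    zwegersTerm M τ v n =
      ((Real.sign ((n : ℝ) + 1 / 2) - E (zwegersArg M τ v n) : ℝ) : ℂ) * zwegersExp M τ v n := by
  rw [zwegersTerm, zwegersExp, zwegersArg, e]
  congr 2
  rcases eq_or_ne M 0 with rfl | hM
  · simp; ring
  · have : (M : ℂ) ≠ 0 := by exact_mod_cast hM
    field_simp
    ring

/-- The exponential grows like e^{πn² Im τ/(2M)}, the Gaussian decays like e^{-πn² Im τ/M}, and half
of the decay survives. In the linear term 6B|n| of `majorant`, 4B comes from the shift in the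
Gaussian and 2B from e^{-2πinv}. -/
theorem norm_zwegersExp_mul_le {M : ℕ} (hM : M ≠ 0) {τ v : ℂ} (hτ : 0 < τ.im) {B : ℝ}
    (hv : |v.im| ≤ B) (n : ℤ) :
    ‖zwegersExp M τ v n‖ * Real.exp (-π * (Real.sqrt (τ.im / M) ^ 2 *
      ((n : ℝ) ^ 2 - 2 * (2 * M * (B / τ.im)) * |(n : ℝ)|))) ≤ majorant M τ.im B n := by
  have hM' : (0 : ℝ) < M := by positivity
  have him : (-((n : ℂ) ^ 2 / (4 * M)) * τ - n * v).im =
      -((n : ℝ) ^ 2 / (4 * M)) * τ.im - n * v.im := by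
    have : (-((n : ℂ) ^ 2 / (4 * M)) * τ - n * v) =
      ((-((n : ℝ) ^ 2 / (4 * M)) : ℝ) : ℂ) * τ - ((n : ℝ) : ℂ) * v := by push_cast; ring
    rw [this, Complex.sub_im, Complex.im_ofReal_mul, Complex.im_ofReal_mul]
  rw [zwegersExp, norm_e, him, Real.sq_sqrt (by positivity), ← Real.exp_add, majorant,
    Real.exp_le_exp]
  have h1 : n * v.im ≤ |(n : ℝ)| * B := by
    refine (le_abs_self _).trans ?_
    rw [abs_mul]
    exact mul_le_mul_of_nonneg_left hv (abs_nonneg _)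
  have h2 : τ.im / M * ((n : ℝ) ^ 2 - 2 * (2 * M * (B / τ.im)) * |(n : ℝ)|) =
      τ.im / M * (n : ℝ) ^ 2 - 4 * B * |(n : ℝ)| := by
    field_simp
    ring
  have h3 : (n : ℝ) ^ 2 / (4 * M) * τ.im = τ.im / M * (n : ℝ) ^ 2 / 4 := by
    field_simp
  have h4 : τ.im / (2 * M) * (n : ℝ) ^ 2 = τ.im / M * (n : ℝ) ^ 2 / 2 := by
    field_simp
  rw [h2, h4]
  have h5 := mul_le_mul_of_nonneg_left h1 Real.pi_pos.le
  have h6 : -((n : ℝ) ^ 2 / (4 * M)) * τ.im = -(τ.im / M * (n : ℝ) ^ 2 / 4) := by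
    rw [← h3]; ring
  rw [h6]
  linarith

theorem abs_zwegers_shift_le {M : ℕ} {y x B : ℝ} (hy : 0 < y) (hx : |x| ≤ B) :
    |2 * (M : ℝ) * (x / y)| ≤ 2 * M * (B / y) := by
  rw [abs_mul, abs_div, abs_of_pos hy, abs_of_nonneg (by positivity : (0 : ℝ) ≤ 2 * M)]
  gcongr

theorem norm_sign_sub_E_mul_zwegersExp_le {M : ℕ} (hM : M ≠ 0) {τ v : ℂ} (hτ : 0 < τ.im) {B : ℝ}
    (hv : |v.im| ≤ B) (n : ℤ) :
    |Real.sign ((n : ℝ) + 1 / 2) - E (zwegersArg M τ v n)| * ‖zwegersExp M τ v n‖ ≤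
      2 * majorant M τ.im B n := by
  have h := abs_sign_sub_E_le n (Real.sqrt_nonneg (τ.im / M))
    (abs_zwegers_shift_le (M := M) hτ hv)
  calc _ ≤ _ * ‖zwegersExp M τ v n‖ := mul_le_mul_of_nonneg_right h (norm_nonneg _)
    _ = 2 * (‖zwegersExp M τ v n‖ * _) := by ring
    _ ≤ _ := by gcongr; exact norm_zwegersExp_mul_le hM hτ hv n

theorem gaussian_mul_norm_zwegersExp_le {M : ℕ} (hM : M ≠ 0) {τ v : ℂ} (hτ : 0 < τ.im) {B : ℝ}
    (hv : |v.im| ≤ B) (n : ℤ) :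
    Real.exp (-π * zwegersArg M τ v n ^ 2) * ‖zwegersExp M τ v n‖ ≤ majorant M τ.im B n := by
  have h := gaussian_shift_le (n := n) (s := Real.sqrt (τ.im / M))
    (abs_zwegers_shift_le (M := M) hτ hv)
  refine (mul_le_mul_of_nonneg_right h (norm_nonneg _)).trans ?_
  rw [mul_comm]
  exact norm_zwegersExp_mul_le hM hτ hv n

theorem summable_zwegersTerm {M : ℕ} (hM : M ≠ 0) {τ : ℂ} (hτ : 0 < τ.im) (v : ℂ) :
    Summable (zwegersTerm M τ v) := by
  refine Summable.of_norm_bounded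
    (((summable_pow_mul_majorant hM hτ |v.im| 0).mul_left 2)) fun n => ?_
  rw [zwegersTerm_eq, norm_mul, Complex.norm_real, Real.norm_eq_abs]
  simpa using norm_sign_sub_E_mul_zwegersExp_le hM hτ le_rfl n

/-! ### Wirtinger derivatives -/

/-- The real-linear map `h ↦ a h + b conj h`. -/
def wirtingerCLM (a b : ℂ) : ℂ →L[ℝ] ℂ :=
  a • ContinuousLinearMap.id ℝ ℂ + b • (Complex.conjCLE : ℂ →L[ℝ] ℂ)

theorem wirtingerCLM_apply (a b h : ℂ) : wirtingerCLM a b h = a * h + b * conj h := by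
  simp [wirtingerCLM]

theorem norm_wirtingerCLM_le (a b : ℂ) : ‖wirtingerCLM a b‖ ≤ ‖a‖ + ‖b‖ := by
  refine ContinuousLinearMap.opNorm_le_bound _ (by positivity) fun h => ?_
  rw [wirtingerCLM_apply, add_mul]
  refine (norm_add_le _ _).trans ?_
  simp

/-- `f` is real differentiable at `v` with `∂f/∂v = a` and `∂f/∂v̄ = b`. -/
def HasWirtingerAt (f : ℂ → ℂ) (a b v : ℂ) : Prop := HasFDerivAt f (wirtingerCLM a b) v

theorem _root_.HasDerivAt.hasWirtingerAt {f : ℂ → ℂ} {a v : ℂ} (h : HasDerivAt f a v) :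
    HasWirtingerAt f a 0 v := by
  refine h.complexToReal_fderiv.congr_fderiv ?_
  ext x
  simp [wirtingerCLM_apply]

/-- The Cauchy–Riemann criterion: without a conjugate-linear part the real derivative is complex
linear. -/
theorem HasWirtingerAt.differentiableAt {f : ℂ → ℂ} {a v : ℂ} (h : HasWirtingerAt f a 0 v) :
    DifferentiableAt ℂ f v := by
  have h' : HasFDerivAt f (ContinuousLinearMap.toSpanSingleton ℂ a : ℂ →L[ℂ] ℂ) v := by
    refine hasFDerivAt_of_restrictScalars ℝ h ?_
    ext x
    simp [wirtingerCLM_apply, mul_comm]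
  exact h'.differentiableAt

theorem HasWirtingerAt.sub {f g : ℂ → ℂ} {a b c d v : ℂ} (hf : HasWirtingerAt f a b v)
    (hg : HasWirtingerAt g c d v) : HasWirtingerAt (fun x => f x - g x) (a - c) (b - d) v := by
  refine (HasFDerivAt.fun_sub hf hg).congr_fderiv ?_
  ext x
  simp [wirtingerCLM_apply]
  ring

theorem HasWirtingerAt.mul {f g : ℂ → ℂ} {a b c d v : ℂ} (hf : HasWirtingerAt f a b v)
    (hg : HasWirtingerAt g c d v) :
    HasWirtingerAt (fun x => f x * g x) (f v * c + a * g v) (f v * d + b * g v) v := by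
  refine (HasFDerivAt.mul hf hg).congr_fderiv ?_
  ext x
  simp [wirtingerCLM_apply]
  ring

theorem HasWirtingerAt.sum {ι : Type*} {s : Finset ι} {f : ι → ℂ → ℂ} {a b : ι → ℂ} {v : ℂ}
    (h : ∀ i ∈ s, HasWirtingerAt (f i) (a i) (b i) v) :
    HasWirtingerAt (fun x => ∑ i ∈ s, f i x) (∑ i ∈ s, a i) (∑ i ∈ s, b i) v := by
  refine (HasFDerivAt.fun_sum h).congr_fderiv ?_
  ext x
  simp [wirtingerCLM_apply, Finset.sum_add_distrib, Finset.sum_mul]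

theorem HasWirtingerAt.comp_const_mul {f : ℂ → ℂ} {a b c v : ℂ}
    (h : HasWirtingerAt f a b (c * v)) :
    HasWirtingerAt (fun x => f (c * x)) (a * c) (b * conj c) v := by
  have h1 : HasFDerivAt (fun x : ℂ => c * x) (wirtingerCLM c 0) v := by
    have : HasDerivAt (fun x : ℂ => c * x) c v := by simpa using (hasDerivAt_id v).const_mul c
    exact this.hasWirtingerAt
  refine (HasFDerivAt.comp v h h1).congr_fderiv ?_
  ext x
  simp [wirtingerCLM_apply]
  ring

theorem hasWirtingerAt_tsum {ι : Type*} {f a b : ι → ℂ → ℂ} {w : ι → ℝ} {v : ℂ}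
    (hw : Summable w)
    (hf : ∀ i, ∀ x ∈ Metric.ball v 1, HasWirtingerAt (f i) (a i x) (b i x) x)
    (ha : ∀ i, ∀ x ∈ Metric.ball v 1, ‖a i x‖ ≤ w i)
    (hb : ∀ i, ∀ x ∈ Metric.ball v 1, ‖b i x‖ ≤ w i)
    (h0 : Summable fun i => f i v) :
    HasWirtingerAt (fun x => ∑' i, f i x) (∑' i, a i v) (∑' i, b i v) v := by
  have hv : v ∈ Metric.ball v 1 := Metric.mem_ball_self one_pos
  have hsa : Summable fun i => a i v := Summable.of_norm_bounded hw fun i => ha i v hv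
  have hsb : Summable fun i => b i v := Summable.of_norm_bounded hw fun i => hb i v hv
  have hbound : ∀ i, ∀ x ∈ Metric.ball v 1, ‖wirtingerCLM (a i x) (b i x)‖ ≤ w i + w i :=
    fun i x hx => (norm_wirtingerCLM_le _ _).trans (add_le_add (ha i x hx) (hb i x hx))
  have := hasFDerivAt_tsum_of_isPreconnected (hw.add hw) Metric.isOpen_ball
    (convex_ball v 1).isPreconnected hf hbound hv h0 hv
  refine this.congr_fderiv ?_
  have hs : Summable fun i => wirtingerCLM (a i v) (b i v) :=
    Summable.of_norm_bounded (hw.add hw) fun i => hbound i v hv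
  ext x
  have hx := (ContinuousLinearMap.apply ℝ ℂ x).map_tsum hs
  simp only [ContinuousLinearMap.apply_apply] at hx
  rw [hx]
  simp only [wirtingerCLM_apply]
  rw [(hsa.mul_right x).tsum_add (hsb.mul_right _), tsum_mul_right, tsum_mul_right]

/-! ### The Wirtinger derivatives of `R` -/

theorem thetaTerm_eq {M : ℕ} (hM : M ≠ 0) (j : ℤ) (τ z : ℂ) (k : ℤ) :
    thetaTerm j M τ z k = e (τ * (((j + (2 * M : ℕ) * k : ℤ) : ℂ) ^ 2 / (4 * M)) +
      ((j + (2 * M : ℕ) * k : ℤ) : ℂ) * z / 2) := by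
  have : (M : ℂ) ≠ 0 := by exact_mod_cast hM
  rw [thetaTerm, qPow_eq_e, ← e_add]
  congr 1
  push_cast
  field_simp
  ring

/-- `∂x/∂(Im v)` for the argument `x` of `E` in the series for `R`. -/
def zwegersSlope (M : ℕ) (τ : ℂ) : ℝ := 2 * M / τ.im * Real.sqrt (τ.im / M)

theorem hasWirtingerAt_zwegersTerm (M : ℕ) (τ v : ℂ) (n : ℤ) :
    HasWirtingerAt (fun v => zwegersTerm M τ v n)
      (((Real.sign ((n : ℝ) + 1 / 2) - E (zwegersArg M τ v n) : ℝ) : ℂ) *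
          (-(2 * π * I * n) * zwegersExp M τ v n) +
        I * zwegersSlope M τ * Real.exp (-π * zwegersArg M τ v n ^ 2) * zwegersExp M τ v n)
      (-I * zwegersSlope M τ * Real.exp (-π * zwegersArg M τ v n ^ 2) * zwegersExp M τ v n) v := by
  have hexp : HasWirtingerAt (fun v => zwegersExp M τ v n)
      (-(2 * π * I * n) * zwegersExp M τ v n) 0 v := by
    have h1 : HasDerivAt (fun v : ℂ => -((n : ℂ) ^ 2 / (4 * M)) * τ - n * v) (-(n : ℂ)) v := by
      have := ((hasDerivAt_id v).const_mul (n : ℂ)).const_sub (-((n : ℂ) ^ 2 / (4 * M)) * τ)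
      rwa [mul_one] at this
    refine HasDerivAt.hasWirtingerAt ?_
    have h2 := (hasDerivAt_e _).comp v h1
    refine HasDerivAt.congr_deriv h2 ?_
    rw [zwegersExp]
    ring
  have harg : HasFDerivAt (fun v : ℂ => zwegersArg M τ v n)
      (zwegersSlope M τ • Complex.imCLM) v := by
    have h1 : HasFDerivAt (fun v : ℂ => (n : ℝ) * Real.sqrt (τ.im / M) +
        zwegersSlope M τ * Complex.imCLM v) (zwegersSlope M τ • Complex.imCLM) v :=
      (Complex.imCLM.hasFDerivAt.const_mul _).const_add _
    refine h1.congr_of_eventuallyEq (Eventually.of_forall fun x => ?_)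
    simp only [zwegersArg, zwegersSlope, Complex.imCLM_apply]
    ring
  have hreal : HasWirtingerAt
      (fun v => ((Real.sign ((n : ℝ) + 1 / 2) - E (zwegersArg M τ v n) : ℝ) : ℂ))
      (I * zwegersSlope M τ * Real.exp (-π * zwegersArg M τ v n ^ 2))
      (-I * zwegersSlope M τ * Real.exp (-π * zwegersArg M τ v n ^ 2)) v := by
    have h2 := (((hasDerivAt_E (zwegersArg M τ v n)).comp_hasFDerivAt v harg).const_sub
      (Real.sign ((n : ℝ) + 1 / 2)))
    have h3 := Complex.ofRealCLM.hasFDerivAt.comp v h2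
    refine HasFDerivAt.congr_fderiv h3 ?_
    ext x
    have him : (x.im : ℂ) = (conj x - x) * I / 2 := by
      apply Complex.ext <;> simp
    simp only [wirtingerCLM_apply, ContinuousLinearMap.comp_apply, neg_apply,
      smul_apply, Complex.imCLM_apply, Complex.ofRealCLM_apply, smul_eq_mul]
    push_cast
    rw [him]
    ring
  have := hreal.mul hexp
  simp only [mul_zero, zero_add] at this
  refine HasFDerivAt.congr_of_eventuallyEq this (Eventually.of_forall fun x => ?_)
  exact zwegersTerm_eq M τ x n

/-- Completing the square: apart from a factor independent of n, the Gaussian turns the exponential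
into the conjugate of a term of Θ_{j,M}(τ, 2v). -/
theorem gaussian_mul_zwegersExp {M : ℕ} (hM : M ≠ 0) {τ : ℂ} (hτ : 0 < τ.im) (v : ℂ) (n : ℤ) :
    (Real.exp (-π * zwegersArg M τ v n ^ 2) : ℂ) * zwegersExp M τ v n =
      Real.exp (-4 * π * M * v.im ^ 2 / τ.im) *
        conj (e (τ * ((n : ℂ) ^ 2 / (4 * M)) + n * (2 * v) / 2)) := by
  have hM' : (M : ℂ) ≠ 0 := by exact_mod_cast hM
  have hy : (τ.im : ℂ) ≠ 0 := by exact_mod_cast hτ.ne'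
  have harg : zwegersArg M τ v n ^ 2 = τ.im / M * ((n : ℝ) + 2 * M * (v.im / τ.im)) ^ 2 := by
    rw [zwegersArg, mul_pow, Real.sq_sqrt (by positivity), mul_comm]
  have hconj : ∀ z : ℂ, conj z = z - 2 * I * z.im := by
    intro z
    apply Complex.ext <;> simp
    ring
  rw [harg, conj_e, zwegersExp, e, e, Complex.ofReal_exp, Complex.ofReal_exp, ← Complex.exp_add,
    ← Complex.exp_add]
  congr 1
  simp only [map_add, map_mul, map_div₀, map_pow, Complex.conj_ofNat, map_intCast, map_natCast]
  rw [hconj τ, hconj v]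
  push_cast
  field_simp
  ring_nf
  simp only [Complex.I_sq]
  ring

/-- The antiholomorphic derivative of `R_{M;j}`, up to the conjugate of a theta function. -/
def dbarFactor (M : ℕ) (τ v : ℂ) : ℂ :=
  -I * zwegersSlope M τ * Real.exp (-4 * π * M * v.im ^ 2 / τ.im)

/-- The sign is constant in v, so differentiating E along v̄ leaves Gaussians, which sum to a
conjugate theta function. The value of ∂R/∂v is never needed and stays existential. -/
theorem exists_hasWirtingerAt_zwegersR {M : ℕ} (hM : M ≠ 0) (j : ℤ) {τ : ℂ} (hτ : 0 < τ.im)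
    (v : ℂ) :
    ∃ a, HasWirtingerAt (zwegersR M j τ) a (dbarFactor M τ v * conj (Theta j M τ (2 * v))) v := by
  -- Bounds the imaginary part on the unit ball about v, where termwise differentiation needs
  -- uniform majorants.
  set B : ℝ := |v.im| + 1
  have hB : ∀ x ∈ Metric.ball v 1, |x.im| ≤ B := by
    intro x hx
    have h1 : |(x - v).im| ≤ ‖x - v‖ := Complex.abs_im_le_norm _
    rw [Metric.mem_ball, dist_eq_norm] at hx
    have h2 : |x.im| ≤ |v.im| + |(x - v).im| := by
      have : x.im = v.im + (x - v).im := by simp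
      rw [this]
      exact abs_add_le _ _
    linarith
  have hinj : Function.Injective fun k : ℤ => j + (2 * M : ℕ) * k := by
    intro a b h
    simpa [hM] using h
  set W : ℤ → ℝ := fun n => 4 * π * (|(n : ℝ)| ^ 1 * majorant M τ.im B n) +
    |zwegersSlope M τ| * (|(n : ℝ)| ^ 0 * majorant M τ.im B n)
  have hW : Summable W := ((summable_pow_mul_majorant hM hτ B 1).mul_left _).add
    ((summable_pow_mul_majorant hM hτ B 0).mul_left _)
  have hb : ∀ n : ℤ, ∀ x : ℂ, |x.im| ≤ B →
      ‖I * zwegersSlope M τ * Real.exp (-π * zwegersArg M τ x n ^ 2) * zwegersExp M τ x n‖ ≤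
        |zwegersSlope M τ| * majorant M τ.im B n := by
    intro n x hx
    rw [norm_mul, norm_mul, norm_mul, Complex.norm_I, one_mul, Complex.norm_real, Complex.norm_real,
      Real.norm_eq_abs, Real.norm_eq_abs, Real.abs_exp, mul_assoc]
    exact mul_le_mul_of_nonneg_left (gaussian_mul_norm_zwegersExp_le hM hτ hx n) (abs_nonneg _)
  have hm : ∀ n, 0 ≤ majorant M τ.im B n := fun n => (Real.exp_pos _).le
  have key := hasWirtingerAt_tsum (v := v) (hW.comp_injective hinj)
    (fun k x _ => hasWirtingerAt_zwegersTerm M τ x (j + (2 * M : ℕ) * k)) ?_ ?_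
    ((summable_zwegersTerm hM hτ v).comp_injective hinj)
  · have hR : zwegersR M j τ = fun x => ∑' k : ℤ, zwegersTerm M τ x (j + (2 * M : ℕ) * k) :=
      funext fun x => zwegersR_eq_tsum hM j τ x
    have hbar : ∑' k : ℤ, -I * zwegersSlope M τ *
        Real.exp (-π * zwegersArg M τ v (j + (2 * M : ℕ) * k) ^ 2) *
          zwegersExp M τ v (j + (2 * M : ℕ) * k) =
        dbarFactor M τ v * conj (Theta j M τ (2 * v)) := by
      rw [Theta, Complex.conj_tsum, ← tsum_mul_left]
      refine tsum_congr fun k => ?_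
      rw [mul_assoc, gaussian_mul_zwegersExp hM hτ, thetaTerm_eq hM, dbarFactor]
      ring
    rw [hbar, ← hR] at key
    exact ⟨_, key⟩
  · intro k x hx
    set n := j + (2 * M : ℕ) * k
    refine (norm_add_le _ _).trans (add_le_add ?_ ?_)
    · rw [norm_mul, norm_mul, Complex.norm_real, Real.norm_eq_abs]
      have h1 : ‖-(2 * π * I * (n : ℂ))‖ = 2 * π * |(n : ℝ)| := by
        simp [abs_of_pos Real.pi_pos]
      rw [h1]
      have := norm_sign_sub_E_mul_zwegersExp_le hM hτ (hB x hx) n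
      calc _ = 2 * π * |(n : ℝ)| * (|Real.sign ((n : ℝ) + 1 / 2) - E (zwegersArg M τ x n)| *
          ‖zwegersExp M τ x n‖) := by ring
        _ ≤ 2 * π * |(n : ℝ)| * (2 * majorant M τ.im B n) := by gcongr
        _ = _ := by ring
    · rw [pow_zero, one_mul]
      exact hb n x (hB x hx)
  · intro k x hx
    set n := j + (2 * M : ℕ) * k
    have h1 := hb n x (hB x hx)
    have h2 : 0 ≤ 4 * π * (|(n : ℝ)| ^ 1 * majorant M τ.im B n) := by
      have := hm n
      positivity
    have h3 : W n = 4 * π * (|(n : ℝ)| ^ 1 * majorant M τ.im B n) +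
      |zwegersSlope M τ| * (|(n : ℝ)| ^ 0 * majorant M τ.im B n) := rfl
    simp only [Function.comp_apply]
    rw [h3, pow_zero, one_mul, neg_mul, neg_mul, neg_mul, norm_neg]
    linarith

/-! ### Theta functions -/

theorem thetaTerm_eq_jacobi {M : ℕ} (hM : M ≠ 0) (j : ℤ) (τ z : ℂ) (k : ℤ) :
    thetaTerm j M τ z k = e (τ * ((j : ℂ) ^ 2 / (4 * M)) + j * z / 2) *
      jacobiTheta₂_term k (M * z + j * τ) (2 * M * τ) := by
  have : (M : ℂ) ≠ 0 := by exact_mod_cast hM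
  have hj : jacobiTheta₂_term k (M * z + j * τ) (2 * M * τ) =
      e (k * (M * z + j * τ) + k ^ 2 * (M * τ)) := by
    rw [jacobiTheta₂_term, e]
    congr 1
    ring
  rw [thetaTerm_eq hM, hj, ← e_add]
  congr 1
  push_cast
  field_simp
  ring

theorem im_two_mul_nat_mul_pos {M : ℕ} (hM : M ≠ 0) {τ : ℂ} (hτ : 0 < τ.im) :
    0 < (2 * M * τ : ℂ).im := by
  have : (2 * M * τ : ℂ) = ((2 * M : ℝ) : ℂ) * τ := by push_cast; ring
  rw [this, Complex.im_ofReal_mul]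
  positivity

theorem summable_thetaTerm {M : ℕ} (hM : M ≠ 0) {τ : ℂ} (hτ : 0 < τ.im) (j : ℤ) (z : ℂ) :
    Summable (thetaTerm j M τ z) := by
  have h := (summable_jacobiTheta₂_term_iff (M * z + j * τ) (2 * M * τ)).mpr
    (im_two_mul_nat_mul_pos hM hτ)
  exact (h.mul_left (e (τ * ((j : ℂ) ^ 2 / (4 * M)) + j * z / 2))).congr fun k =>
    (thetaTerm_eq_jacobi hM j τ z k).symm

theorem Theta_eq_jacobi {M : ℕ} (hM : M ≠ 0) (j : ℤ) (τ z : ℂ) :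
    Theta j M τ z = e (τ * ((j : ℂ) ^ 2 / (4 * M)) + j * z / 2) *
      jacobiTheta₂ (M * z + j * τ) (2 * M * τ) := by
  rw [Theta, jacobiTheta₂, ← tsum_mul_left]
  exact tsum_congr fun k => thetaTerm_eq_jacobi hM j τ z k

theorem Theta_neg_index {M : ℕ} (hM : M ≠ 0) (j : ℤ) (τ z : ℂ) :
    Theta (-j) M τ z = Theta j M τ (-z) := by
  rw [Theta, Theta, ← (Equiv.neg ℤ).tsum_eq]
  refine tsum_congr fun k => ?_
  rw [thetaTerm_eq hM, thetaTerm_eq hM]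
  congr 1
  simp only [Equiv.neg_apply]
  push_cast
  ring

theorem jacobiTheta₂_eq_sum_Theta {M : ℕ} (hM : M ≠ 0) {τ : ℂ} (hτ : 0 < τ.im) (j : ℤ) (z : ℂ) :
    jacobiTheta₂ (z / 2 - j / (2 * M)) (τ / (2 * M)) =
      ∑ l ∈ Finset.range (2 * M), e (-(j * l / (2 * M))) * Theta l M τ z := by
  have hM' : (M : ℂ) ≠ 0 := by exact_mod_cast hM
  have him : 0 < (τ / (2 * M)).im := by
    have : (τ / (2 * M) : ℂ) = ((1 / (2 * M) : ℝ) : ℂ) * τ := by push_cast; ring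
    rw [this, Complex.im_ofReal_mul]
    positivity
  rw [jacobiTheta₂, tsum_eq_sum_range_tsum (N := 2 * M) (by omega)
    ((summable_jacobiTheta₂_term_iff _ _).mpr him)]
  refine Finset.sum_congr rfl fun l _ => ?_
  rw [Theta, ← tsum_mul_left]
  refine tsum_congr fun k => ?_
  rw [thetaTerm_eq hM, ← e_add]
  have hj : ∀ (n : ℤ) (x t : ℂ), jacobiTheta₂_term n x t = e (n * x + n ^ 2 * t / 2) := by
    intro n x t
    rw [jacobiTheta₂_term, e]
    congr 1
    ring
  rw [hj]
  refine e_congr (-(j * k)) ?_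
  push_cast
  field_simp
  ring

/-- Θ_{j,M} at -1/τ is a Jacobi theta function with modular parameter -2M/τ = -1/(τ/2M). The
functional equation moves it to τ/(2M), and splitting that series by residues modulo 2M produces the
finite Fourier matrix. -/
theorem Theta_neg_one_div {M : ℕ} (hM : M ≠ 0) {τ : ℂ} (hτ : 0 < τ.im) (j : ℤ) (z : ℂ) :
    Theta j M (-1 / τ) (z / τ) = (-I * (τ / (2 * M))) ^ (1 / 2 : ℂ) * e (M * z ^ 2 / (4 * τ)) *
      ∑ l ∈ Finset.range (2 * M), e (-(j * l / (2 * M))) * Theta l M τ z := by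
  have hM' : (M : ℂ) ≠ 0 := by exact_mod_cast hM
  have hτ0 : τ ≠ 0 := by
    rintro rfl
    simp at hτ
  have hbase : (-I * (τ / (2 * M))) ^ (1 / 2 : ℂ) ≠ 0 := by
    rw [Complex.cpow_ne_zero_iff_of_exponent_ne_zero (by norm_num)]
    exact mul_ne_zero (neg_ne_zero.mpr I_ne_zero) (div_ne_zero hτ0 (mul_ne_zero two_ne_zero hM'))
  rw [← jacobiTheta₂_eq_sum_Theta hM hτ, jacobiTheta₂_functional_equation, Theta_eq_jacobi hM]
  have h1 : (z / 2 - j / (2 * M)) / (τ / (2 * M)) = M * (z / τ) + j * (-1 / τ) := by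
    field_simp
    ring
  have h2 : -1 / (τ / (2 * M)) = 2 * M * (-1 / τ) := by
    field_simp
  have h3 : cexp (-π * I * (z / 2 - j / (2 * M)) ^ 2 / (τ / (2 * M))) =
      e (-(z / 2 - j / (2 * M)) ^ 2 * M / τ) := by
    rw [e]
    congr 1
    field_simp
  rw [h1, h2, h3]
  have h4 : e (-1 / τ * ((j : ℂ) ^ 2 / (4 * M)) + j * (z / τ) / 2) =
      e (M * z ^ 2 / (4 * τ)) * e (-(z / 2 - j / (2 * M)) ^ 2 * M / τ) := by
    rw [← e_add]
    congr 1
    field_simp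
    ring
  rw [h4]
  field_simp

theorem sum_range_e_eq_zero {N : ℕ} {l l' : ℕ} (hl : l < N) (hl' : l' < N) (h : l ≠ l') :
    ∑ j ∈ Finset.range N, e (j * ((l : ℂ) - l') / N) = 0 := by
  have hN : (N : ℂ) ≠ 0 := by exact_mod_cast (by omega : N ≠ 0)
  have hpow : ∀ j : ℕ, e (j * ((l : ℂ) - l') / N) = e (((l : ℂ) - l') / N) ^ j := by
    intro j
    rw [← e_nat_mul, mul_div_assoc]
  simp only [hpow]
  have hone : e (((l : ℂ) - l') / N) ≠ 1 := by
    rw [Ne, e_eq_one_iff]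
    rintro ⟨n, hn⟩
    rw [div_eq_iff hN] at hn
    have hn' : (l : ℤ) - l' = n * N := by exact_mod_cast hn
    have hdvd : (N : ℤ) ∣ (l : ℤ) - l' := ⟨n, by rw [hn', mul_comm]⟩
    have := Int.eq_zero_of_abs_lt_dvd hdvd (by rw [abs_lt]; omega)
    omega
  rw [geom_sum_eq hone, ← e_nat_mul, mul_div_cancel₀ _ hN]
  have : e ((l : ℂ) - l') = 1 := by exact_mod_cast e_int ((l : ℤ) - l')
  rw [this, sub_self, zero_div]

/-- The kernel `∑_j conj Θ_{j,M}(τ, 2v) Θ_{j,M}(τ, 2u)`. -/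
def thetaKernel (M : ℕ) (τ u v : ℂ) : ℂ :=
  ∑ j ∈ Finset.range (2 * M), conj (Theta j M τ (2 * v)) * Theta j M τ (2 * u)

/-- Only the modulus of the square root enters the kernel, so the choice of branch plays no role. -/
theorem norm_sq_cpow_half (x : ℂ) : conj (x ^ (1 / 2 : ℂ)) * x ^ (1 / 2 : ℂ) = ‖x‖ := by
  rw [mul_comm, Complex.mul_conj, Complex.normSq_eq_norm_sq, ← norm_pow]
  congr 2
  rw [← Complex.cpow_nat_mul]
  norm_num

/-- Orthogonality of the characters of ℤ/2M collapses the double sum over l, l' to its diagonal with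
weight 2M, and |c|² · 2M = |τ| for the prefactor c. -/
theorem thetaKernel_neg_one_div {M : ℕ} (hM : M ≠ 0) {τ : ℂ} (hτ : 0 < τ.im) (u v : ℂ) :
    thetaKernel M (-1 / τ) (u / τ) (v / τ) =
      ‖τ‖ * conj (e (M * v ^ 2 / τ)) * e (M * u ^ 2 / τ) * thetaKernel M τ u v := by
  have hM' : (M : ℂ) ≠ 0 := by exact_mod_cast hM
  set c : ℂ := (-I * (τ / (2 * M))) ^ (1 / 2 : ℂ)
  have hc : conj c * c * (2 * M) = ‖τ‖ := by
    rw [norm_sq_cpow_half]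
    simp
    field_simp
  have hT : ∀ (j : ℤ) (x : ℂ), Theta j M (-1 / τ) (2 * (x / τ)) = c * e (M * x ^ 2 / τ) *
      ∑ l ∈ Finset.range (2 * M), e (-(j * l / (2 * M))) * Theta l M τ (2 * x) := by
    intro j x
    rw [← mul_div_assoc, Theta_neg_one_div hM hτ]
    congr 3
    ring
  have horth : ∀ l ∈ Finset.range (2 * M), ∀ l' ∈ Finset.range (2 * M),
      ∑ j ∈ Finset.range (2 * M), conj (e (-(((j : ℕ) : ℤ) * l / (2 * M)))) *
        e (-(((j : ℕ) : ℤ) * l' / (2 * M))) = if l = l' then (2 * M : ℂ) else 0 := by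
    intro l hl l' hl'
    have h1 : ∀ j : ℕ, conj (e (-((j : ℤ) * l / (2 * M)))) * e (-((j : ℤ) * l' / (2 * M))) =
        e (j * ((l : ℂ) - l') / ((2 * M : ℕ) : ℂ)) := by
      intro j
      rw [conj_e, ← e_add]
      congr 1
      simp only [map_neg, map_div₀, map_mul, map_intCast, map_natCast, Complex.conj_ofNat]
      push_cast
      ring
    simp only [h1]
    split_ifs with h
    · subst h
      simp [e_zero]
    · exact sum_range_e_eq_zero (Finset.mem_range.mp hl) (Finset.mem_range.mp hl') h
  have hstep : ∀ j ∈ Finset.range (2 * M),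
      conj (Theta j M (-1 / τ) (2 * (v / τ))) * Theta j M (-1 / τ) (2 * (u / τ)) =
      conj c * c * conj (e (M * v ^ 2 / τ)) * e (M * u ^ 2 / τ) *
        ∑ l ∈ Finset.range (2 * M), ∑ l' ∈ Finset.range (2 * M),
          conj (Theta l M τ (2 * v)) * Theta l' M τ (2 * u) *
          (conj (e (-(((j : ℕ) : ℤ) * l / (2 * M)))) * e (-(((j : ℕ) : ℤ) * l' / (2 * M)))) := by
    intro j _
    rw [hT, hT, map_mul, map_mul, map_sum]
    have : ∀ A B C D S T : ℂ, A * B * S * (C * D * T) = A * C * B * D * (S * T) := by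
      intros; ring
    rw [this, Finset.sum_mul_sum]
    congr 1
    refine Finset.sum_congr rfl fun l _ => Finset.sum_congr rfl fun l' _ => ?_
    rw [map_mul]
    ring
  rw [thetaKernel, Finset.sum_congr rfl hstep, ← Finset.mul_sum, Finset.sum_comm]
  have hinner : ∀ l ∈ Finset.range (2 * M), ∑ j ∈ Finset.range (2 * M),
      ∑ l' ∈ Finset.range (2 * M), conj (Theta l M τ (2 * v)) * Theta l' M τ (2 * u) *
        (conj (e (-(((j : ℕ) : ℤ) * l / (2 * M)))) * e (-(((j : ℕ) : ℤ) * l' / (2 * M)))) =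
      2 * M * (conj (Theta l M τ (2 * v)) * Theta l M τ (2 * u)) := by
    intro l hl
    rw [Finset.sum_comm]
    calc _ = ∑ l' ∈ Finset.range (2 * M), conj (Theta l M τ (2 * v)) * Theta l' M τ (2 * u) *
        (if l = l' then (2 * M : ℂ) else 0) := by
          refine Finset.sum_congr rfl fun l' hl' => ?_
          rw [← Finset.mul_sum, horth l hl l' hl']
      _ = _ := by
          simp only [mul_ite, mul_zero, Finset.sum_ite_eq, hl, if_true]
          ring
  rw [Finset.sum_congr rfl hinner, ← Finset.mul_sum, ← thetaKernel, ← hc]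
  ring

/-! ### Appell sums -/

theorem half_le_norm_one_sub_e {x : ℂ} (hx : 1 ≤ |x.im|) : 1 / 2 ≤ ‖1 - e x‖ := by
  have hexp : 2 ≤ Real.exp (2 * π) := by
    have := Real.add_one_le_exp (2 * π)
    linarith [Real.pi_gt_three]
  rcases le_abs'.mp hx with h | h
  · have h1 : 2 ≤ ‖e x‖ := by
      rw [norm_e]
      refine hexp.trans (Real.exp_le_exp.mpr ?_)
      nlinarith [Real.pi_pos]
    have h2 := norm_sub_norm_le (e x) 1
    rw [norm_one, norm_sub_rev] at h2
    linarith
  · have h1 : ‖e x‖ ≤ 1 / 2 := by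
      rw [norm_e]
      have h3 : Real.exp (-2 * π * x.im) ≤ Real.exp (-(2 * π)) :=
        Real.exp_le_exp.mpr (by nlinarith [Real.pi_pos])
      rw [Real.exp_neg] at h3
      refine h3.trans ?_
      rw [one_div]
      exact inv_anti₀ two_pos hexp
    have h2 := norm_sub_norm_le 1 (e x)
    rw [norm_one] at h2
    linarith

/-- For all but finitely many n the imaginary part of w + nτ exceeds 1 in modulus near w₀, giving
the bound 1/2; continuity handles the rest. The set s allows a singular index to be left out, which
is what residues and isolation of the poles require. -/
theorem eventually_le_norm_one_sub_e {τ : ℂ} (hτ : 0 < τ.im) {w₀ : ℂ} {s : Set ℤ}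
    (hs : ∀ n ∈ s, e (w₀ + n * τ) ≠ 1) :
    ∃ δ > 0, ∀ᶠ w in 𝓝 w₀, ∀ n ∈ s, δ ≤ ‖1 - e (w + n * τ)‖ := by
  have hfin : ∀ F : Finset ℤ, ∃ δ > 0, ∀ᶠ w in 𝓝 w₀, ∀ n ∈ F, n ∈ s →
      δ ≤ ‖1 - e (w + n * τ)‖ := by
    intro F
    induction F using Finset.induction_on with
    | empty => exact ⟨1, one_pos, by simp⟩
    | insert a F _ ih =>
      obtain ⟨δ, hδ, h⟩ := ih
      by_cases ha : a ∈ s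
      · have hpos : 0 < ‖1 - e (w₀ + a * τ)‖ :=
          norm_pos_iff.mpr (sub_ne_zero.mpr (hs a ha).symm)
        have hcont : Continuous fun w : ℂ => ‖1 - e (w + a * τ)‖ :=
          (continuous_const.sub (continuous_e.comp (continuous_id.add continuous_const))).norm
        have hev := hcont.continuousAt.eventually_const_lt (half_lt_self hpos)
        refine ⟨min δ (‖1 - e (w₀ + a * τ)‖ / 2), lt_min hδ (by positivity), ?_⟩
        filter_upwards [h, hev] with w h1 h2 n hn hns
        rcases Finset.mem_insert.mp hn with rfl | hn
        · exact (min_le_right _ _).trans h2.le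
        · exact (min_le_left _ _).trans (h1 n hn hns)
      · refine ⟨δ, hδ, ?_⟩
        filter_upwards [h] with w h1 n hn hns
        rcases Finset.mem_insert.mp hn with rfl | hn
        · exact absurd hns ha
        · exact h1 n hn hns
  obtain ⟨N, hN⟩ := exists_nat_ge ((|w₀.im| + 2) / τ.im)
  rw [div_le_iff₀ hτ] at hN
  obtain ⟨δ, hδ, h⟩ := hfin (Finset.Icc (-N : ℤ) N)
  refine ⟨min δ (1 / 2), lt_min hδ (by norm_num), ?_⟩
  filter_upwards [h, Metric.ball_mem_nhds w₀ one_pos] with w h1 hw n hns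
  by_cases hn : n ∈ Finset.Icc (-N : ℤ) N
  · exact (min_le_left _ _).trans (h1 n hn hns)
  · refine (min_le_right _ _).trans (half_le_norm_one_sub_e ?_)
    have h2 : |(w - w₀).im| ≤ ‖w - w₀‖ := Complex.abs_im_le_norm _
    rw [Metric.mem_ball, dist_eq_norm] at hw
    rw [Complex.sub_im] at h2
    have h3 := abs_le.mp (h2.trans hw.le)
    have him : (w + n * τ).im = w.im + n * τ.im := by simp
    have h4 := neg_abs_le w₀.im
    have h5 := le_abs_self w₀.im
    rw [him, le_abs']
    rw [Finset.mem_Icc, not_and_or, not_le, not_le] at hn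
    rcases hn with hn | hn
    · left
      have : (n : ℝ) ≤ -N := by exact_mod_cast hn.le
      have := mul_le_mul_of_nonneg_right this hτ.le
      linarith
    · right
      have : (N : ℝ) ≤ n := by exact_mod_cast hn.le
      have := mul_le_mul_of_nonneg_right this hτ.le
      linarith

theorem norm_div_one_sub_e_le {c x : ℂ} {δ : ℝ} (hδ : 0 < δ) (h : c ≠ 0 → δ ≤ ‖1 - e x‖) :
    ‖c / (1 - e x)‖ ≤ ‖c‖ * δ⁻¹ := by
  rcases eq_or_ne c 0 with rfl | hc
  · simp
  · rw [norm_div, div_eq_mul_inv]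
    exact mul_le_mul_of_nonneg_left (inv_anti₀ hδ (h hc)) (norm_nonneg c)

theorem summable_div_one_sub_e {τ : ℂ} (hτ : 0 < τ.im) {c : ℤ → ℂ} (hc : Summable c) {w : ℂ}
    (hw : ∀ n, c n ≠ 0 → e (w + n * τ) ≠ 1) :
    Summable fun n : ℤ => c n / (1 - e (w + n * τ)) := by
  obtain ⟨δ, hδ, h⟩ := eventually_le_norm_one_sub_e hτ (s := {n | c n ≠ 0}) hw
  exact Summable.of_norm_bounded (hc.norm.mul_right δ⁻¹)
    fun n => norm_div_one_sub_e_le hδ (h.self_of_nhds n)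

theorem differentiableAt_tsum_div_one_sub_e {τ : ℂ} (hτ : 0 < τ.im) {c : ℤ → ℂ} (hc : Summable c)
    {w₀ : ℂ} (hw : ∀ n, c n ≠ 0 → e (w₀ + n * τ) ≠ 1) :
    DifferentiableAt ℂ (fun w => ∑' n : ℤ, c n / (1 - e (w + n * τ))) w₀ := by
  obtain ⟨δ, hδ, h⟩ := eventually_le_norm_one_sub_e hτ (s := {n | c n ≠ 0}) hw
  obtain ⟨ε, hε, hball⟩ := Metric.eventually_nhds_iff_ball.mp h
  refine (differentiableOn_tsum_of_summable_norm (hc.norm.mul_right δ⁻¹) (fun n => ?_)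
    Metric.isOpen_ball fun n w hw' => norm_div_one_sub_e_le hδ (hball w hw' n)).differentiableAt
    (Metric.ball_mem_nhds w₀ hε)
  intro w hw'
  rcases eq_or_ne (c n) 0 with hn | hn
  · simp only [hn, zero_div]
    exact differentiableWithinAt_const _
  · refine (DifferentiableAt.div (differentiableAt_const _) ?_ ?_).differentiableWithinAt
    · exact (differentiableAt_const _).sub
        ((differentiable_e _).comp w (differentiableAt_id.add_const _))
    · exact norm_pos_iff.mp (hδ.trans_le (hball w hw' n hn))

/-- The numerators `q^{M n²} e^{4πi M n u}` of the Appell sum. -/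
def appellCoeff (M : ℕ) (τ u : ℂ) (n : ℤ) : ℂ := e (M * (n : ℂ) ^ 2 * τ + 2 * M * n * u)

theorem summable_appellCoeff {M : ℕ} (hM : M ≠ 0) {τ : ℂ} (hτ : 0 < τ.im) (u : ℂ) :
    Summable (appellCoeff M τ u) := by
  refine (summable_thetaTerm hM hτ 0 (2 * u)).congr fun n => ?_
  have hM' : (M : ℂ) ≠ 0 := by exact_mod_cast hM
  rw [thetaTerm_eq hM, appellCoeff]
  congr 1
  push_cast
  field_simp
  ring

/-- The level `M` Appell function `∑_n q^{M n²} e^{4πi M n u} / (1 - e^{2πi(u - v)} q^n)`. -/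
def appell (M : ℕ) (τ u v : ℂ) : ℂ := ∑' n : ℤ, appellCoeff M τ u n / (1 - e (u - v + n * τ))

/-- `w` does not lie in the lattice `ℤ + ℤτ`. -/
def OffLattice (τ w : ℂ) : Prop := ∀ j k : ℤ, w ≠ j + k * τ

theorem OffLattice.e_ne_one {τ w : ℂ} (h : OffLattice τ w) (n : ℤ) : e (w + n * τ) ≠ 1 := by
  rw [Ne, e_eq_one_iff]
  rintro ⟨k, hk⟩
  refine h k (-n) ?_
  rw [eq_sub_of_add_eq hk]
  push_cast
  ring

theorem OffLattice.neg {τ w : ℂ} (h : OffLattice τ w) : OffLattice τ (-w) := by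
  intro j k hjk
  refine h (-j) (-k) ?_
  rw [← neg_neg w, hjk]
  push_cast
  ring

theorem OffLattice.add {τ w : ℂ} (h : OffLattice τ w) (a b : ℤ) :
    OffLattice τ (w + (a + b * τ)) := by
  intro j k hjk
  refine h (j - a) (k - b) ?_
  rw [eq_sub_of_add_eq hjk]
  push_cast
  ring

theorem summable_appell {M : ℕ} (hM : M ≠ 0) {τ : ℂ} (hτ : 0 < τ.im) {u v : ℂ}
    (h : OffLattice τ (u - v)) :
    Summable fun n : ℤ => appellCoeff M τ u n / (1 - e (u - v + n * τ)) :=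
  summable_div_one_sub_e hτ (summable_appellCoeff hM hτ u) fun n _ => h.e_ne_one n

theorem differentiableAt_appell {M : ℕ} (hM : M ≠ 0) {τ : ℂ} (hτ : 0 < τ.im) {u v : ℂ}
    (h : OffLattice τ (u - v)) : DifferentiableAt ℂ (fun v => appell M τ u v) v :=
  (differentiableAt_tsum_div_one_sub_e hτ (summable_appellCoeff hM hτ u)
    fun n _ => h.e_ne_one n).comp v (differentiableAt_id.const_sub u)

theorem tendsto_mul_inv_one_sub_e :
    Tendsto (fun w : ℂ => w / (1 - e w)) (𝓝[≠] 0) (𝓝 (-(2 * π * I)⁻¹)) := by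
  have h := (hasDerivAt_e 0).tendsto_slope_zero
  rw [e_zero, mul_one] at h
  have h' := (h.inv₀ Complex.two_pi_I_ne_zero).neg
  refine h'.congr fun w => ?_
  rw [zero_add, smul_eq_mul, mul_inv, inv_inv, ← neg_sub (e w) 1, div_neg, div_eq_mul_inv]

/-- The residue of the Appell function at `v = u`. -/
theorem tendsto_mul_appell {M : ℕ} (hM : M ≠ 0) {τ : ℂ} (hτ : 0 < τ.im) (u : ℂ) :
    Tendsto (fun v => (v - u) * appell M τ u v) (𝓝[≠] u) (𝓝 (2 * π * I)⁻¹) := by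
  -- Near v = u only the term n = 0 is singular. Setting its coefficient to 0 leaves a sum g
  -- holomorphic at 0, since the quotient with numerator 0 is 0 even where the denominator vanishes.
  set c : ℤ → ℂ := fun n => if n = 0 then 0 else appellCoeff M τ u n with hcdef
  have hc : Summable c := by
    refine Summable.of_norm_bounded (summable_appellCoeff hM hτ u).norm fun n => ?_
    simp only [hcdef]
    split_ifs
    · simp
    · exact le_rfl
  have hne : ∀ n, c n ≠ 0 → e (0 + n * τ) ≠ 1 := by
    intro n hn h1
    have hn0 : n ≠ 0 := by
      rintro rfl
      exact hn (by simp [hcdef])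
    obtain ⟨k, hk⟩ := e_eq_one_iff.mp h1
    have him := congrArg Complex.im hk
    simp only [zero_add, Complex.mul_im, Complex.intCast_re, Complex.intCast_im, zero_mul,
      add_zero] at him
    rcases mul_eq_zero.mp him with h | h
    · exact hn0 (by exact_mod_cast h)
    · exact hτ.ne' h
  set g : ℂ → ℂ := fun w => ∑' n : ℤ, c n / (1 - e (w + n * τ))
  have hg : ContinuousAt g 0 := (differentiableAt_tsum_div_one_sub_e hτ hc hne).continuousAt
  have hsub : Tendsto (fun v : ℂ => u - v) (𝓝[≠] u) (𝓝[≠] 0) := by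
    refine tendsto_nhdsWithin_iff.mpr ⟨?_, ?_⟩
    · have : Continuous fun v : ℂ => u - v := by fun_prop
      simpa using (this.tendsto u).mono_left nhdsWithin_le_nhds
    · filter_upwards [self_mem_nhdsWithin] with v hv
      exact sub_ne_zero.mpr (Ne.symm hv)
  have hev : ∀ᶠ w in 𝓝 (0 : ℂ), ∀ n, c n ≠ 0 → e (w + n * τ) ≠ 1 := by
    obtain ⟨δ, hδ, h⟩ := eventually_le_norm_one_sub_e hτ (s := {n | c n ≠ 0}) hne
    filter_upwards [h] with w hw n hn h1
    have := hw n hn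
    rw [h1, sub_self, norm_zero] at this
    linarith
  have hsplit : ∀ᶠ v in 𝓝[≠] u, -((u - v) / (1 - e (u - v))) + (v - u) * g (u - v) =
      (v - u) * appell M τ u v := by
    filter_upwards [(hsub.mono_right nhdsWithin_le_nhds).eventually hev] with v hv
    have hs1 : HasSum (fun n : ℤ => c n / (1 - e (u - v + n * τ))) (g (u - v)) :=
      (summable_div_one_sub_e hτ hc hv).hasSum
    have hs2 := hs1.add (hasSum_ite_eq (0 : ℤ) (1 / (1 - e (u - v))))
    have h3 : appell M τ u v = g (u - v) + 1 / (1 - e (u - v)) := by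
      rw [← hs2.tsum_eq, appell]
      refine tsum_congr fun n => ?_
      simp only [hcdef]
      split_ifs with hn
      · subst hn
        simp [appellCoeff, e_zero]
      · ring
    rw [h3]
    ring
  refine Tendsto.congr' hsplit ?_
  have h1 := (tendsto_mul_inv_one_sub_e.comp hsub).neg
  have h2 : Tendsto (fun v => (v - u) * g (u - v)) (𝓝[≠] u) (𝓝 (0 * g 0)) := by
    refine Tendsto.mul ?_ (hg.tendsto.comp (hsub.mono_right nhdsWithin_le_nhds))
    have : Continuous fun v : ℂ => v - u := by fun_prop
    simpa using (this.tendsto u).mono_left nhdsWithin_le_nhds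
  have h3 := h1.add h2
  simpa using h3

/-! ### Vanishing of quasi-periodic functions of negative index -/

theorem offLattice_iff_e_ne_one {τ w : ℂ} : OffLattice τ w ↔ ∀ n : ℤ, e (w + n * τ) ≠ 1 := by
  refine ⟨fun h n => h.e_ne_one n, fun h j k hjk => h (-k) ?_⟩
  rw [e_eq_one_iff]
  exact ⟨j, by rw [hjk]; push_cast; ring⟩

/-- The points of u + ℤ + ℤτ are isolated. An index n regular at c stays regular nearby; for a
singular one, a nearby zero of 1 - e^{2πi(u - v + nτ)} differs from c by an integer of modulus less
than 1. -/
theorem eventually_offLattice {τ : ℂ} (hτ : 0 < τ.im) (u c : ℂ) :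
    ∀ᶠ v in 𝓝[≠] c, OffLattice τ (u - v) := by
  obtain ⟨δ, hδ, h⟩ := eventually_le_norm_one_sub_e hτ (w₀ := u - c)
    (s := {n | e (u - c + n * τ) ≠ 1}) fun n hn => hn
  have hcont : Tendsto (fun v : ℂ => u - v) (𝓝 c) (𝓝 (u - c)) :=
    (continuous_const.sub continuous_id).tendsto c
  filter_upwards [nhdsWithin_le_nhds (hcont.eventually h),
    nhdsWithin_le_nhds (Metric.ball_mem_nhds c one_pos), self_mem_nhdsWithin] with v h1 h2 h3
  rw [offLattice_iff_e_ne_one]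
  intro n hn
  by_cases hs : e (u - c + n * τ) = 1
  · have h4 : e (v - c) = 1 := by
      have : v - c = (u - c + n * τ) + -(u - v + n * τ) := by ring
      rw [this, e_add, e_neg, hs, hn]
      simp
    obtain ⟨k, hk⟩ := e_eq_one_iff.mp h4
    rw [Metric.mem_ball, dist_eq_norm, hk, Complex.norm_intCast] at h2
    have hk0 : k = 0 := by
      rw [← Int.abs_lt_one_iff]
      exact_mod_cast h2
    rw [hk0, Int.cast_zero] at hk
    exact h3 (sub_eq_zero.mp hk)
  · have := h1 n hs
    rw [hn, sub_self, norm_zero] at this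
    linarith

theorem OffLattice.sub_add {τ u v : ℂ} (h : OffLattice τ (u - v)) (a b : ℤ) :
    OffLattice τ (u - (v + (a + b * τ))) := by
  convert h.add (-a) (-b) using 1
  push_cast
  ring

theorem periodic_of_add_one_of_add_tau {τ u : ℂ} {G : ℂ → ℝ}
    (h1 : ∀ v, OffLattice τ (u - v) → G (v + 1) = G v)
    (h2 : ∀ v, OffLattice τ (u - v) → G (v + τ) = G v)
    {v : ℂ} (hv : OffLattice τ (u - v)) (a b : ℤ) : G (v + (a + b * τ)) = G v := by
  have ha : ∀ v, OffLattice τ (u - v) → ∀ a : ℤ, G (v + a) = G v := by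
    intro v hv a
    have hoff : ∀ a : ℤ, OffLattice τ (u - (v + a)) := fun a => by
      simpa using hv.sub_add a 0
    induction a using Int.induction_on with
    | zero => simp
    | succ i ih =>
      rw [← ih, ← h1 _ (hoff i)]
      congr 1
      push_cast
      ring
    | pred i ih =>
      rw [← ih, ← h1 _ (hoff (-i - 1))]
      congr 1
      push_cast
      ring
  have hb : ∀ v, OffLattice τ (u - v) → ∀ b : ℤ, G (v + b * τ) = G v := by
    intro v hv b
    have hoff : ∀ b : ℤ, OffLattice τ (u - (v + b * τ)) := fun b => by
      simpa using hv.sub_add 0 b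
    induction b using Int.induction_on with
    | zero => simp
    | succ i ih =>
      rw [← ih, ← h2 _ (hoff i)]
      congr 1
      push_cast
      ring
    | pred i ih =>
      rw [← ih, ← h2 _ (hoff (-i - 1))]
      congr 1
      push_cast
      ring
  have hoff : OffLattice τ (u - (v + a)) := by simpa using hv.sub_add a 0
  rw [← add_assoc, hb _ hoff, ha _ hv]

/-- Every point is congruent modulo `ℤ + ℤτ` to a point of the cell centred at `u`. -/
theorem exists_mem_cell {τ : ℂ} (hτ : 0 < τ.im) (u v : ℂ) :
    ∃ a b : ℤ, ∃ β ∈ Set.Icc (-1 / 2 : ℝ) (1 / 2), ∃ α ∈ Set.Icc (-1 / 2 : ℝ) (1 / 2),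
      v + (a + b * τ) = u + β + α * τ := by
  have hy : τ.im ≠ 0 := hτ.ne'
  set α : ℝ := (v - u).im / τ.im with hα
  set β : ℝ := (v - u).re - α * τ.re with hβ
  have hv : v = u + β + α * τ := by
    apply Complex.ext
    · simp [hβ]
      ring
    · simp [hα, hy]
  have hround : ∀ x : ℝ, x - round x ∈ Set.Icc (-1 / 2 : ℝ) (1 / 2) := by
    intro x
    have := abs_le.mp (abs_sub_round x)
    exact ⟨by linarith [this.1], this.2⟩
  refine ⟨-round β, -round α, β - round β, hround β, α - round α, hround α, ?_⟩
  rw [hv]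
  push_cast
  ring

/-- Centring the closed cell at u keeps its boundary free of poles: coordinates in [-1/2, 1/2] are
integral only when they vanish. -/
theorem offLattice_of_mem_cell {τ : ℂ} (hτ : 0 < τ.im) {u : ℂ} {α β : ℝ}
    (hα : α ∈ Set.Icc (-1 / 2 : ℝ) (1 / 2)) (hβ : β ∈ Set.Icc (-1 / 2 : ℝ) (1 / 2))
    (hne : u + β + α * τ ≠ u) : OffLattice τ (u - (u + β + α * τ)) := by
  intro j k hjk
  have habs : ∀ (x : ℝ) (n : ℤ), x ∈ Set.Icc (-1 / 2 : ℝ) (1 / 2) → -x = n → x = 0 := by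
    intro x n hx h
    have hn : n = 0 := by
      rw [← Int.abs_lt_one_iff]
      have : |(n : ℝ)| < 1 := by
        rw [← h, abs_lt]
        constructor <;> linarith [hx.1, hx.2]
      exact_mod_cast this
    rw [hn, Int.cast_zero] at h
    linarith
  have him := congrArg Complex.im hjk
  have hre := congrArg Complex.re hjk
  simp at him hre
  have h1 : (-α - k) * τ.im = 0 := by linarith
  have h2 : -α = k := by
    rcases mul_eq_zero.mp h1 with h | h
    · linarith
    · exact absurd h hτ.ne'
  have hα0 := habs α k hα h2
  have hk : (k : ℝ) = 0 := by rw [← h2, hα0, neg_zero]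
  rw [hα0, hk] at hre
  have hβ0 := habs β j hβ (by linarith)
  exact hne (by rw [hα0, hβ0]; simp)

/-- A theta function of index -M vanishes. The multiplier makes |f(v)| e^{2πM (Im v)²/Im τ} doubly
periodic, hence bounded by compactness of a cell, and f decays with it. Nothing is assumed about the
values of f on u + ℤ + ℤτ, so the argument runs on limits there. -/
theorem eq_zero_of_negative_index {M : ℕ} (hM : M ≠ 0) {τ : ℂ} (hτ : 0 < τ.im) {u : ℂ} {f : ℂ → ℂ}
    (hd : ∀ v, OffLattice τ (u - v) → DifferentiableAt ℂ f v)
    (hres : Tendsto (fun v => (v - u) * f v) (𝓝[≠] u) (𝓝 0))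
    (h1 : ∀ v, OffLattice τ (u - v) → f (v + 1) = f v)
    (h2 : ∀ v, OffLattice τ (u - v) → f (v + τ) = e (M * (2 * v + τ)) * f v)
    {v : ℂ} (hv : OffLattice τ (u - v)) : f v = 0 := by
  have hM' : (0 : ℝ) < M := by positivity
  -- the norm of `f`, corrected to become doubly periodic
  set G : ℂ → ℝ := fun v => ‖f v‖ * Real.exp (2 * π * M * v.im ^ 2 / τ.im) with hG
  have hG1 : ∀ v, OffLattice τ (u - v) → G (v + 1) = G v := by
    intro v hv
    simp only [hG, h1 v hv, Complex.add_im, Complex.one_im, add_zero]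
  have hG2 : ∀ v, OffLattice τ (u - v) → G (v + τ) = G v := by
    intro v hv
    have him : (M * (2 * v + τ) : ℂ).im = M * (2 * v.im + τ.im) := by simp
    simp only [hG, h2 v hv, norm_mul, norm_e, him, Complex.add_im]
    rw [mul_comm (Real.exp _) ‖f v‖, mul_assoc, ← Real.exp_add]
    congr 2
    field_simp
    ring
  -- the limit of `f` at `u`
  have hlim : Tendsto f (𝓝[≠] u) (𝓝 (limUnder (𝓝[≠] u) f)) := by
    -- Vanishing of (v - u) f(v) in the limit says f = o(1/(v - u)), so the singularity at u is
    -- removable.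
    refine tendsto_limUnder_of_differentiable_on_punctured_nhds_of_isLittleO
      ((eventually_offLattice hτ u u).mono fun z hz => hd z hz) ?_
    rw [Asymptotics.isLittleO_iff_tendsto']
    · have hz : Tendsto (fun z : ℂ => (z - u) * f u) (𝓝[≠] u) (𝓝 0) := by
        have : Continuous fun z : ℂ => (z - u) * f u := by fun_prop
        simpa using (this.tendsto u).mono_left nhdsWithin_le_nhds
      have := hres.sub hz
      rw [sub_zero] at this
      refine this.congr fun z => ?_
      rw [div_inv_eq_mul]
      ring
    · filter_upwards [self_mem_nhdsWithin] with z hz h0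
      exact absurd (sub_eq_zero.mp (inv_eq_zero.mp h0)) hz
  obtain ⟨C, hC⟩ : ∃ C, ∀ v, OffLattice τ (u - v) → G v ≤ C := by
    -- With its limit inserted at u, the only possible singularity in the cell, F is continuous on a
    -- compact set.
    set F := Function.update f u (limUnder (𝓝[≠] u) f) with hF
    set cell : ℝ × ℝ → ℂ := fun p => u + p.1 + p.2 * τ with hcell
    have hcont : ContinuousOn (fun p => ‖F (cell p)‖ *
        Real.exp (2 * π * M * (cell p).im ^ 2 / τ.im))
        (Set.Icc (-1 / 2 : ℝ) (1 / 2) ×ˢ Set.Icc (-1 / 2 : ℝ) (1 / 2)) := by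
      have hcc : Continuous cell := by fun_prop
      refine ContinuousOn.mul (ContinuousOn.norm ?_) (Continuous.continuousOn (by fun_prop))
      intro p hp
      have hFat : ContinuousAt F (cell p) := by
        by_cases hpu : cell p = u
        · rw [hpu]
          exact continuousAt_update_same.mpr hlim
        · rw [hF, continuousAt_update_of_ne hpu]
          exact (hd _ (offLattice_of_mem_cell hτ hp.2 hp.1 hpu)).continuousAt
      exact (hFat.comp hcc.continuousAt).continuousWithinAt
    obtain ⟨C, hC⟩ := (isCompact_Icc.prod isCompact_Icc).bddAbove_image hcont
    refine ⟨C, fun v hv => ?_⟩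
    obtain ⟨a, b, β, hβ, α, hα, hab⟩ := exists_mem_cell hτ u v
    rw [← periodic_of_add_one_of_add_tau hG1 hG2 hv a b]
    have hne : v + (a + b * τ) ≠ u := by
      intro h
      have := hv.sub_add a b 0 0
      rw [h] at this
      simp at this
    refine le_trans (le_of_eq ?_) (hC ⟨(β, α), ⟨hβ, hα⟩, rfl⟩)
    simp only [hG, hcell, ← hab, hF, Function.update_of_ne hne]
  have hC' : ∀ v, OffLattice τ (u - v) → ‖f v‖ ≤ C := by
    intro v hv
    refine le_trans ?_ (hC v hv)
    exact le_mul_of_one_le_right (norm_nonneg _) (Real.one_le_exp (by positivity))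
  -- the entire extension
  set h : ℂ → ℂ := fun v => limUnder (𝓝[≠] v) f with hh
  have hhf : ∀ v, OffLattice τ (u - v) → h v = f v := fun v hv =>
    ((hd v hv).continuousAt.tendsto.mono_left nhdsWithin_le_nhds).limUnder_eq
  have hdiff : Differentiable ℂ h := by
    intro c
    obtain ⟨ε, hε, hball⟩ :=
      Metric.mem_nhdsWithin_iff.mp (eventually_offLattice hτ u c)
    have hoff : ∀ v ∈ Metric.ball c ε \ {c}, OffLattice τ (u - v) := fun v hv => hball hv
    -- The global bound C makes the singularity at every translate of u removable, so the residue
    -- condition is needed at u alone.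
    have hup := Complex.differentiableOn_update_limUnder_of_bddAbove
      (Metric.ball_mem_nhds c hε) (f := f)
      (fun v hv => (hd v (hoff v hv)).differentiableWithinAt)
      ⟨C, by rintro _ ⟨v, hv, rfl⟩; exact hC' v (hoff v hv)⟩
    refine (hup.differentiableAt (Metric.ball_mem_nhds c hε)).congr_of_eventuallyEq ?_
    filter_upwards [Metric.ball_mem_nhds c hε] with v hv
    by_cases hvc : v = c
    · subst hvc
      simp [hh]
    · rw [Function.update_of_ne hvc]
      exact hhf v (hoff v ⟨hv, hvc⟩)
  have hbdd : ∀ c, ‖h c‖ ≤ C := by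
    intro c
    refine le_of_tendsto ((hdiff c).continuousAt.norm.tendsto.mono_left
      (nhdsWithin_le_nhds (s := {c}ᶜ))) ?_
    filter_upwards [eventually_offLattice hτ u c] with v hv
    rw [hhf v hv]
    exact hC' v hv
  have hconst : ∀ z w, h z = h w := fun z w =>
    hdiff.apply_eq_apply_of_bounded (isBounded_iff_forall_norm_le.mpr
      ⟨C, by rintro _ ⟨c, rfl⟩; exact hbdd c⟩) z w
  by_contra hne
  -- A nonzero constant forces the multiplier to be 1 everywhere off the poles. Comparing v with v +
  -- τ gives e^{4πiMτ} = 1, impossible because its modulus is less than 1.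
  have hfac : ∀ w, OffLattice τ (u - w) → e (M * (2 * w + τ)) = 1 := by
    intro w hw
    have hw' : OffLattice τ (u - (w + τ)) := by simpa using hw.sub_add 0 1
    have h3 : f (w + τ) = f v := by rw [← hhf _ hw', ← hhf _ hv]; exact hconst _ _
    have h4 : f w = f v := by rw [← hhf _ hw, ← hhf _ hv]; exact hconst _ _
    have h5 := h2 w hw
    rw [h3, h4] at h5
    exact (mul_eq_right₀ hne).mp h5.symm
  have h3 := hfac v hv
  have h4 := hfac (v + τ) (by simpa using hv.sub_add 0 1)
  have h5 : e (2 * M * τ) = 1 := by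
    have : (M * (2 * (v + τ) + τ) : ℂ) = M * (2 * v + τ) + 2 * M * τ := by ring
    rwa [this, e_add, h3, one_mul] at h4
  have h6 := congrArg norm h5
  rw [norm_e, norm_one, Real.exp_eq_one_iff] at h6
  have := im_two_mul_nat_mul_pos hM hτ
  nlinarith [Real.pi_pos]

/-! ### Elliptic transformations of the modified Appell function -/

/-- The nonholomorphic correction of the Appell function. -/
def appellCorr (M : ℕ) (τ u v : ℂ) : ℂ :=
  1 / 2 * ∑ j ∈ Finset.range (2 * M), zwegersR M j τ v * Theta j M τ (2 * u)

/-- The modified Appell function. -/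
def appellMod (M : ℕ) (τ u v : ℂ) : ℂ := appell M τ u v - appellCorr M τ u v

theorem zwegersR_mul_Theta_periodic {M : ℕ} (hM : M ≠ 0) (τ τ' v z : ℂ) (j : ℤ) :
    zwegersR M (j + (2 * M : ℕ)) τ v * Theta (j + (2 * M : ℕ)) M τ' z =
      zwegersR M j τ v * Theta j M τ' z := by
  rw [Nat.cast_mul, Nat.cast_ofNat, zwegersR_add_two_mul, Theta_add_two_mul j M hM]

/-- A sum over a residue class of a function supported on `[0, N)` has only one term. -/
theorem tsum_residue_of_support {N : ℕ} {g : ℤ → ℂ} (hg : ∀ n : ℤ, ¬(0 ≤ n ∧ n < N) → g n = 0)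
    {j : ℕ} (hj : j < N) : ∑' k : ℤ, g (j + N * k) = g j := by
  rw [tsum_eq_single 0]
  · simp
  · intro k hk
    apply hg
    rintro ⟨h1, h2⟩
    rcases lt_or_gt_of_ne hk with h | h
    · have : (N : ℤ) * k ≤ N * (-1) := by gcongr; omega
      omega
    · have : (N : ℤ) * 1 ≤ N * k := by gcongr; omega
      omega

theorem summable_zwegersTerm_residue {M : ℕ} (hM : M ≠ 0) {τ : ℂ} (hτ : 0 < τ.im) (j : ℤ)
    (v : ℂ) : Summable fun k : ℤ => zwegersTerm M τ v (j + (2 * M : ℕ) * k) :=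
  (summable_zwegersTerm hM hτ v).comp_injective
    (Subtype.val_injective.comp (residueEquiv M hM j).injective)

theorem summable_residue_of_support {N : ℕ} {g : ℤ → ℂ} (hN : N ≠ 0) (A : ℕ)
    (hg : ∀ n : ℤ, ¬(0 ≤ n ∧ n < A) → g n = 0) (j : ℤ) :
    Summable fun k : ℤ => g (j + N * k) := by
  have hs : Summable g := by
    refine summable_of_ne_finset_zero (s := Finset.Ico (0 : ℤ) A) fun n hn => hg n ?_
    rwa [Finset.mem_Ico] at hn
  refine hs.comp_injective (i := fun k : ℤ => j + N * k) fun a b h => ?_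
  simpa [hN] using h

/-- E is odd, and sign(n + 1/2) is odd in n except at n = 0, where both signs are +1; hence the
extra 2. -/
theorem zwegersTerm_neg_neg (M : ℕ) (τ v : ℂ) (n : ℤ) :
    zwegersTerm M τ (-v) (-n) = (if n = 0 then 2 else 0) - zwegersTerm M τ v n := by
  have harg : zwegersArg M τ (-v) (-n) = -zwegersArg M τ v n := by
    simp only [zwegersArg, Complex.neg_im, Int.cast_neg]
    ring
  have hexp : zwegersExp M τ (-v) (-n) = zwegersExp M τ v n := by
    simp only [zwegersExp]
    congr 1
    push_cast
    ring
  rw [zwegersTerm_eq, zwegersTerm_eq, harg, hexp, E_neg, sign_add_half, sign_add_half]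
  rcases lt_trichotomy n 0 with h | h | h
  · rw [if_pos (by omega), if_neg (by omega), if_neg (by omega)]
    push_cast
    ring
  · subst h
    simp [zwegersExp, e_zero]
    ring
  · rw [if_neg (by omega), if_neg (by omega), if_pos (by omega)]
    push_cast
    ring

theorem zwegersR_neg_neg {M : ℕ} (hM : M ≠ 0) {τ : ℂ} (hτ : 0 < τ.im) (v : ℂ) {j : ℕ}
    (hj : j < 2 * M) :
    zwegersR M (-j) τ (-v) = (if (j : ℤ) = 0 then 2 else 0) - zwegersR M j τ v := by
  have hsupp : ∀ n : ℤ, ¬(0 ≤ n ∧ n < (1 : ℕ)) → (if n = 0 then (2 : ℂ) else 0) = 0 := by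
    intro n hn
    rw [if_neg]
    omega
  rw [zwegersR_eq_tsum hM, zwegersR_eq_tsum hM, ← (Equiv.neg ℤ).tsum_eq]
  -- The exceptional term is written as a series over the residue class, so that the two sides can
  -- be compared term by term.
  rw [← tsum_residue_of_support (N := 2 * M) (g := fun n : ℤ => if n = 0 then (2 : ℂ) else 0)
    (fun n hn => hsupp n (by omega)) hj, ← Summable.tsum_sub
    (summable_residue_of_support (by omega) 1 hsupp j) (summable_zwegersTerm_residue hM hτ j v)]
  refine tsum_congr fun k => ?_
  rw [← zwegersTerm_neg_neg]
  congr 1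
  simp only [Equiv.neg_apply]
  ring

theorem Theta_zero_eq_tsum {M : ℕ} (hM : M ≠ 0) (τ u : ℂ) :
    Theta 0 M τ (2 * u) = ∑' n : ℤ, appellCoeff M τ u n := by
  have hM' : (M : ℂ) ≠ 0 := by exact_mod_cast hM
  refine tsum_congr fun n => ?_
  rw [thetaTerm_eq hM, appellCoeff]
  congr 1
  push_cast
  field_simp
  ring

/-- With n ↦ -n the denominators become 1 - X⁻¹, and 1/(1 - X⁻¹) = 1 - 1/(1 - X); the 1 sums to
Θ_{0,M}. -/
theorem appell_neg_neg {M : ℕ} (hM : M ≠ 0) {τ : ℂ} (hτ : 0 < τ.im) {u v : ℂ}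
    (h : OffLattice τ (u - v)) :
    appell M τ (-u) (-v) = Theta 0 M τ (2 * u) - appell M τ u v := by
  rw [Theta_zero_eq_tsum hM, appell, appell, ← (Equiv.neg ℤ).tsum_eq,
    ← Summable.tsum_sub (summable_appellCoeff hM hτ u) (summable_appell hM hτ h)]
  refine tsum_congr fun n => ?_
  have hc : appellCoeff M τ (-u) (-n) = appellCoeff M τ u n := by
    simp only [appellCoeff]
    congr 1
    push_cast
    ring
  have he : e (-u - -v + ((-n : ℤ) : ℂ) * τ) = (e (u - v + n * τ))⁻¹ := by
    rw [← e_neg]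
    congr 1
    push_cast
    ring
  rw [Equiv.neg_apply, hc, he]
  have h1 : 1 - e (u - v + n * τ) ≠ 0 := sub_ne_zero.mpr (h.e_ne_one n).symm
  have h2 : e (u - v + n * τ) - 1 ≠ 0 := sub_ne_zero.mpr (h.e_ne_one n)
  have h3 := e_ne_zero (u - v + n * τ)
  field_simp
  ring

theorem appellMod_neg_neg {M : ℕ} (hM : M ≠ 0) {τ : ℂ} (hτ : 0 < τ.im) {u v : ℂ}
    (h : OffLattice τ (u - v)) : appellMod M τ (-u) (-v) = -appellMod M τ u v := by
  have hcorr : appellCorr M τ (-u) (-v) = Theta 0 M τ (2 * u) - appellCorr M τ u v := by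
    have hneg := sum_range_periodic_neg (N := 2 * M)
      (p := fun j => zwegersR M j τ (-v) * Theta j M τ (2 * -u)) (by omega)
      (zwegersR_mul_Theta_periodic hM τ τ (-v) (2 * -u))
    rw [appellCorr, ← hneg]
    have : ∀ j ∈ Finset.range (2 * M), zwegersR M (-j) τ (-v) * Theta (-j) M τ (2 * -u) =
        (if (j : ℤ) = 0 then 2 * Theta 0 M τ (2 * u) else 0) -
          zwegersR M j τ v * Theta j M τ (2 * u) := by
      intro j hj
      rw [zwegersR_neg_neg hM hτ v (Finset.mem_range.mp hj), Theta_neg_index hM, mul_neg, neg_neg]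
      split_ifs with h0
      · rw [h0]
        ring
      · ring
    rw [Finset.sum_congr rfl this, Finset.sum_sub_distrib, appellCorr]
    simp only [Nat.cast_eq_zero, Finset.sum_ite_eq', Finset.mem_range]
    rw [if_pos (by omega)]
    ring
  rw [appellMod, appellMod, hcorr, appell_neg_neg hM hτ h]
  ring

/-- The shift v ↦ v + τ/2 adds M to the index inside E, which n ↦ n - M undoes. Only the sign
notices, and it flips exactly for 0 ≤ n < M. -/
theorem zwegersTerm_add_half {M : ℕ} (hM : M ≠ 0) {τ : ℂ} (hτ : 0 < τ.im) (v : ℂ) (n : ℤ) :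
    zwegersTerm M τ (v + τ / 2) (n - M) = e (M * τ / 4 + M * v) *
      (zwegersTerm M τ v n - if 0 ≤ n ∧ n < M then 2 * zwegersExp M τ v n else 0) := by
  have hM' : (M : ℂ) ≠ 0 := by exact_mod_cast hM
  have harg : zwegersArg M τ (v + τ / 2) (n - M) = zwegersArg M τ v n := by
    have him : (v + τ / 2).im = v.im + τ.im / 2 := by simp
    simp only [zwegersArg, him]
    congr 1
    push_cast
    field_simp
    ring
  have hexp : zwegersExp M τ (v + τ / 2) (n - M) =
      e (M * τ / 4 + M * v) * zwegersExp M τ v n := by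
    simp only [zwegersExp]
    rw [← e_add]
    congr 1
    push_cast
    field_simp
    ring
  rw [zwegersTerm_eq, zwegersTerm_eq, harg, hexp, sign_add_half, sign_add_half]
  split_ifs with h1 h2 h3 h4 h5 h6 <;> first | omega | (push_cast; ring)

theorem zwegersR_add_half {M : ℕ} (hM : M ≠ 0) {τ : ℂ} (hτ : 0 < τ.im) (v : ℂ) {j : ℕ}
    (hj : j < 2 * M) :
    zwegersR M (j + -M) τ (v + τ / 2) = e (M * τ / 4 + M * v) *
      (zwegersR M j τ v - if j < M then 2 * zwegersExp M τ v j else 0) := by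
  set g : ℤ → ℂ := fun n => if 0 ≤ n ∧ n < M then 2 * zwegersExp M τ v n else 0 with hg
  have hsupp : ∀ n : ℤ, ¬(0 ≤ n ∧ n < M) → g n = 0 := fun n hn => if_neg hn
  have hgj : g j = if j < M then 2 * zwegersExp M τ v j else 0 := by
    simp [hg]
  rw [zwegersR_eq_tsum hM, zwegersR_eq_tsum hM, ← hgj,
    ← tsum_residue_of_support (N := 2 * M) (g := g) (fun n hn => hsupp n (by omega)) hj,
    ← Summable.tsum_sub (summable_zwegersTerm_residue hM hτ j v)
    (summable_residue_of_support (by omega) M hsupp j), ← tsum_mul_left]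
  refine tsum_congr fun k => ?_
  rw [← zwegersTerm_add_half hM hτ]
  congr 1
  ring

theorem Theta_add_tau {M : ℕ} (hM : M ≠ 0) (τ z : ℂ) (j : ℤ) :
    Theta (j + -M) M τ (z + τ) = e (-(M * τ / 4) - M * z / 2) * Theta j M τ z := by
  have hM' : (M : ℂ) ≠ 0 := by exact_mod_cast hM
  rw [Theta, Theta, ← tsum_mul_left]
  refine tsum_congr fun k => ?_
  rw [thetaTerm_eq hM, thetaTerm_eq hM, ← e_add]
  congr 1
  push_cast
  field_simp
  ring

/-- Identifies the sign-flip terms of the correction with the powers X^k of the geometric sum in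
`appell_add_half`. -/
theorem zwegersExp_mul_Theta {M : ℕ} (hM : M ≠ 0) (τ u v : ℂ) (k : ℕ) :
    zwegersExp M τ v k * Theta k M τ (2 * u) =
      ∑' n : ℤ, appellCoeff M τ u n * e (u - v + n * τ) ^ k := by
  have hM' : (M : ℂ) ≠ 0 := by exact_mod_cast hM
  rw [Theta, ← tsum_mul_left]
  refine tsum_congr fun n => ?_
  rw [thetaTerm_eq hM, zwegersExp, appellCoeff, ← e_nat_mul, ← e_add, ← e_add]
  congr 1
  push_cast
  field_simp
  ring

theorem summable_appellCoeff_mul_pow {M : ℕ} (hM : M ≠ 0) {τ : ℂ} (hτ : 0 < τ.im) (u v : ℂ)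
    (k : ℕ) : Summable fun n : ℤ => appellCoeff M τ u n * e (u - v + n * τ) ^ k := by
  have hM' : (M : ℂ) ≠ 0 := by exact_mod_cast hM
  refine ((summable_thetaTerm hM hτ k (2 * u)).mul_left (zwegersExp M τ v k)).congr fun n => ?_
  rw [thetaTerm_eq hM, zwegersExp, appellCoeff, ← e_nat_mul, ← e_add, ← e_add]
  congr 1
  push_cast
  field_simp
  ring

/-- Here u - v is unchanged, so X = e^{2πi(u - v)} q^n is too, while the numerator gains X^M. Then
X^M/(1 - X) = 1/(1 - X) - ∑_{k<M} X^k. -/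
theorem appell_add_half {M : ℕ} (hM : M ≠ 0) {τ : ℂ} (hτ : 0 < τ.im) {u v : ℂ}
    (h : OffLattice τ (u - v)) :
    appell M τ (u + τ / 2) (v + τ / 2) = e (M * (v - u)) *
      (appell M τ u v - ∑ k ∈ Finset.range M, zwegersExp M τ v k * Theta k M τ (2 * u)) := by
  have hsum : ∑ k ∈ Finset.range M, zwegersExp M τ v k * Theta k M τ (2 * u) =
      ∑' n : ℤ, ∑ k ∈ Finset.range M, appellCoeff M τ u n * e (u - v + n * τ) ^ k := by
    rw [Summable.tsum_finsetSum fun k _ => summable_appellCoeff_mul_pow hM hτ u v k]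
    exact Finset.sum_congr rfl fun k _ => zwegersExp_mul_Theta hM τ u v k
  rw [hsum, appell, appell, ← Summable.tsum_sub (summable_appell hM hτ h)
    (summable_sum fun k _ => summable_appellCoeff_mul_pow hM hτ u v k), ← tsum_mul_left]
  refine tsum_congr fun n => ?_
  have h1 : 1 - e (u - v + n * τ) ≠ 0 := sub_ne_zero.mpr (h.e_ne_one n).symm
  have hX : u + τ / 2 - (v + τ / 2) + n * τ = u - v + n * τ := by ring
  have hc : appellCoeff M τ (u + τ / 2) n =
      e (M * (v - u)) * (appellCoeff M τ u n * e (u - v + n * τ) ^ M) := by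
    rw [← e_nat_mul, appellCoeff, appellCoeff, ← e_add, ← e_add]
    congr 1
    ring
  have hgeom := geom_sum_mul_neg (e (u - v + n * τ)) M
  rw [hX, hc, ← Finset.mul_sum]
  field_simp
  linear_combination e (M * (v - u)) * appellCoeff M τ u n * hgeom

theorem appellMod_add_half {M : ℕ} (hM : M ≠ 0) {τ : ℂ} (hτ : 0 < τ.im) {u v : ℂ}
    (h : OffLattice τ (u - v)) :
    appellMod M τ (u + τ / 2) (v + τ / 2) = e (M * (v - u)) * appellMod M τ u v := by
  have hcorr : appellCorr M τ (u + τ / 2) (v + τ / 2) = e (M * (v - u)) *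
      (appellCorr M τ u v - ∑ k ∈ Finset.range M, zwegersExp M τ v k * Theta k M τ (2 * u)) := by
    have hshift := sum_range_periodic_add (N := 2 * M)
      (p := fun j => zwegersR M j τ (v + τ / 2) * Theta j M τ (2 * (u + τ / 2))) (by omega)
      (zwegersR_mul_Theta_periodic hM τ τ (v + τ / 2) (2 * (u + τ / 2))) (-M)
    rw [appellCorr, ← hshift]
    have hterm : ∀ j ∈ Finset.range (2 * M),
        zwegersR M (j + -M) τ (v + τ / 2) * Theta (j + -M) M τ (2 * (u + τ / 2)) =
        e (M * (v - u)) * (zwegersR M j τ v * Theta j M τ (2 * u) -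
          if j < M then 2 * (zwegersExp M τ v j * Theta j M τ (2 * u)) else 0) := by
      intro j hj
      have h2 : 2 * (u + τ / 2) = 2 * u + τ := by ring
      have h3 : e (M * (v - u)) = e (M * τ / 4 + M * v) * e (-(M * τ / 4) - M * (2 * u) / 2) := by
        rw [← e_add]
        congr 1
        ring
      rw [zwegersR_add_half hM hτ v (Finset.mem_range.mp hj), h2, Theta_add_tau hM, h3]
      split_ifs <;> ring
    rw [Finset.sum_congr rfl hterm, ← Finset.mul_sum, Finset.sum_sub_distrib, appellCorr,
      ← Finset.sum_filter]
    have hfil : (Finset.range (2 * M)).filter (fun j => j < M) = Finset.range M := by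
      ext j
      simp only [Finset.mem_filter, Finset.mem_range]
      omega
    rw [hfil, ← Finset.mul_sum]
    ring
  rw [appellMod, appellMod, hcorr, appell_add_half hM hτ h]
  ring

theorem appellMod_add_int_mul_half {M : ℕ} (hM : M ≠ 0) {τ : ℂ} (hτ : 0 < τ.im) {u v : ℂ}
    (h : OffLattice τ (u - v)) (l : ℤ) :
    appellMod M τ (u + l / 2 * τ) (v + l / 2 * τ) = e (l * M * (v - u)) * appellMod M τ u v := by
  have hstep : ∀ l : ℤ, appellMod M τ (u + (l + 1 : ℤ) / 2 * τ) (v + (l + 1 : ℤ) / 2 * τ) =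
      e (M * (v - u)) * appellMod M τ (u + l / 2 * τ) (v + l / 2 * τ) := by
    intro l
    have h' : OffLattice τ (u + l / 2 * τ - (v + l / 2 * τ)) := by
      simpa only [add_sub_add_right_eq_sub] using h
    have := appellMod_add_half hM hτ h'
    rw [add_sub_add_right_eq_sub] at this
    rw [← this]
    congr 1 <;> (push_cast; ring)
  induction l using Int.induction_on with
  | zero => simp [e_zero]
  | succ i ih =>
    rw [hstep, ih, ← mul_assoc, ← e_add]
    congr 2
    push_cast
    ring
  | pred i ih =>
    have := hstep (-i - 1)
    rw [sub_add_cancel, ih] at this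
    rw [← mul_right_inj' (e_ne_zero (M * (v - u))), ← this, ← mul_assoc, ← e_add]
    congr 2
    push_cast
    ring

/-- With v fixed R is untouched, and reindexing A and each Θ_{j,M} by n gives one common multiplier;
no boundary terms arise. -/
theorem appellMod_add_int_mul_tau {M : ℕ} (hM : M ≠ 0) (τ u v : ℂ) (n : ℤ) :
    appellMod M τ (u + n * τ) v =
      e (-(M * (n : ℂ) ^ 2 * τ) - 2 * M * n * u) * appellMod M τ u v := by
  have hM' : (M : ℂ) ≠ 0 := by exact_mod_cast hM
  have happ : appell M τ (u + n * τ) v =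
      e (-(M * (n : ℂ) ^ 2 * τ) - 2 * M * n * u) * appell M τ u v := by
    rw [appell, appell, ← tsum_mul_left,
      ← (Equiv.addRight n).tsum_eq (fun k : ℤ => e (-(M * (n : ℂ) ^ 2 * τ) - 2 * M * n * u) *
        (appellCoeff M τ u k / (1 - e (u - v + k * τ))))]
    refine tsum_congr fun k => ?_
    rw [Equiv.coe_addRight, mul_div_assoc', appellCoeff, appellCoeff, ← e_add]
    congr 2
    · push_cast
      ring
    · push_cast
      ring_nf
  have hTheta : ∀ j : ℤ, Theta j M τ (2 * (u + n * τ)) =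
      e (-(M * (n : ℂ) ^ 2 * τ) - 2 * M * n * u) * Theta j M τ (2 * u) := by
    intro j
    rw [Theta, Theta, ← tsum_mul_left,
      ← (Equiv.addRight n).tsum_eq (fun k : ℤ => e (-(M * (n : ℂ) ^ 2 * τ) - 2 * M * n * u) *
        thetaTerm j M τ (2 * u) k)]
    refine tsum_congr fun k => ?_
    rw [Equiv.coe_addRight, thetaTerm_eq hM, thetaTerm_eq hM, ← e_add]
    congr 1
    push_cast
    field_simp
    ring
  have hcorr : appellCorr M τ (u + n * τ) v =
      e (-(M * (n : ℂ) ^ 2 * τ) - 2 * M * n * u) * appellCorr M τ u v := by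
    simp only [appellCorr, hTheta, Finset.mul_sum]
    refine Finset.sum_congr rfl fun j _ => ?_
    ring
  rw [appellMod, appellMod, happ, hcorr, mul_sub]

theorem appellMod_add_mul_tau {M : ℕ} (hM : M ≠ 0) {τ : ℂ} (hτ : 0 < τ.im) {u v : ℂ}
    (h : OffLattice τ (u - v)) {a b : ℝ} (hab : IsHalfIntegralPair a b) :
    appellMod M τ (u + a * τ) (v + b * τ) =
      e (M * (((b : ℂ) ^ 2 - (a : ℂ) ^ 2) * τ + 2 * (-a * u + b * v))) * appellMod M τ u v := by
  obtain ⟨-, ⟨l, hl⟩, ⟨n, hn⟩⟩ := hab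
  -- Since b = l/2 and a + b = n, the shift splits into the diagonal half-period shift by l/2 and an
  -- integral shift of u by n - l.
  have ha : a = ((n - l : ℤ) : ℝ) + l / 2 := by
    push_cast
    linarith
  have hu : u + a * τ = u + l / 2 * τ + ((n - l : ℤ) : ℂ) * τ := by
    rw [ha]
    push_cast
    ring
  have hv : v + b * τ = v + l / 2 * τ := by
    rw [hl]
    push_cast
    ring
  rw [hu, hv, appellMod_add_int_mul_tau hM, appellMod_add_int_mul_half hM hτ h, ← mul_assoc,
    ← e_add, ha, hl]
  congr 2
  push_cast
  ring

theorem appellMod_add_real {M : ℕ} (hM : M ≠ 0) (τ u v : ℂ) {a b : ℝ}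
    (hab : IsHalfIntegralPair a b) : appellMod M τ (u + a) (v + b) = appellMod M τ u v := by
  have hM' : (M : ℂ) ≠ 0 := by exact_mod_cast hM
  obtain ⟨⟨k, hk⟩, ⟨l, hl⟩, ⟨n, hn⟩⟩ := hab
  have hkl : k + l = 2 * n := by
    have : (k : ℝ) + l = 2 * n := by rw [hk, hl] at hn; linarith
    exact_mod_cast this
  have hk2 : (k : ℂ) = 2 * n - l := by
    have : ((k + l : ℤ) : ℂ) = ((2 * n : ℤ) : ℂ) := by rw [hkl]
    push_cast at this
    linear_combination this
  have haC : (a : ℂ) = n - l / 2 := by rw [hk]; push_cast; rw [hk2]; ring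
  have hbC : (b : ℂ) = l / 2 := by rw [hl]; push_cast; ring
  have happ : appell M τ (u + a) (v + b) = appell M τ u v := by
    refine tsum_congr fun i => ?_
    congr 1
    · refine e_congr (M * i * (2 * n - l)) ?_
      rw [haC]
      push_cast
      ring
    · congr 1
      refine e_congr (n - l) ?_
      rw [haC, hbC]
      push_cast
      ring
  have hR : ∀ j : ℤ, zwegersR M j τ (v + b) = e (-(j * l / 2)) * zwegersR M j τ v := by
    intro j
    rw [zwegersR_eq_tsum hM, zwegersR_eq_tsum hM, ← tsum_mul_left]
    refine tsum_congr fun i => ?_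
    have harg : zwegersArg M τ (v + b) (j + (2 * M : ℕ) * i) =
        zwegersArg M τ v (j + (2 * M : ℕ) * i) := by
      simp [zwegersArg]
    have hexp : zwegersExp M τ (v + b) (j + (2 * M : ℕ) * i) =
        e (-(j * l / 2)) * zwegersExp M τ v (j + (2 * M : ℕ) * i) := by
      rw [zwegersExp, zwegersExp, ← e_add]
      refine e_congr (-(M * i * l)) ?_
      rw [hbC]
      push_cast
      ring
    rw [zwegersTerm_eq, zwegersTerm_eq, harg, hexp]
    ring
  have hTheta : ∀ j : ℤ, Theta j M τ (2 * (u + a)) = e (-(j * l / 2)) * Theta j M τ (2 * u) := by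
    intro j
    rw [Theta, Theta, ← tsum_mul_left]
    refine tsum_congr fun i => ?_
    rw [thetaTerm_eq hM, thetaTerm_eq hM, ← e_add]
    refine e_congr (M * i * (2 * n - l) + j * n) ?_
    rw [haC]
    push_cast
    ring
  rw [appellMod, appellMod, happ, appellCorr, appellCorr]
  congr 2
  refine Finset.sum_congr rfl fun j _ => ?_
  rw [hR, hTheta]
  -- R and Θ acquire the same factor (-1)^{jl}, which squares to 1.
  have : e (-(((j : ℕ) : ℤ) * l / 2)) * e (-(((j : ℕ) : ℤ) * l / 2)) = 1 := by
    rw [← e_add, ← e_int (-(j * l))]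
    congr 1
    push_cast
    ring
  linear_combination zwegersR M j τ v * Theta j M τ (2 * u) * this

/-- R_{M;j} and Θ_{j,M} acquire inverse phases e^{∓πi j²/(2M)}, while A is unchanged. -/
theorem appellMod_tau_add_one {M : ℕ} (hM : M ≠ 0) (τ u v : ℂ) :
    appellMod M (τ + 1) u v = appellMod M τ u v := by
  have hM' : (M : ℂ) ≠ 0 := by exact_mod_cast hM
  have happ : appell M (τ + 1) u v = appell M τ u v := by
    refine tsum_congr fun i => ?_
    congr 1
    · refine e_congr (M * i ^ 2) ?_
      push_cast
      ring
    · congr 1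
      refine e_congr i ?_
      ring
  have hR : ∀ j : ℤ, zwegersR M j (τ + 1) v = e (-((j : ℂ) ^ 2 / (4 * M))) * zwegersR M j τ v := by
    intro j
    rw [zwegersR_eq_tsum hM, zwegersR_eq_tsum hM, ← tsum_mul_left]
    refine tsum_congr fun i => ?_
    have harg : zwegersArg M (τ + 1) v (j + (2 * M : ℕ) * i) =
        zwegersArg M τ v (j + (2 * M : ℕ) * i) := by
      simp [zwegersArg]
    have hexp : zwegersExp M (τ + 1) v (j + (2 * M : ℕ) * i) =
        e (-((j : ℂ) ^ 2 / (4 * M))) * zwegersExp M τ v (j + (2 * M : ℕ) * i) := by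
      rw [zwegersExp, zwegersExp, ← e_add]
      refine e_congr (-(j * i + M * i ^ 2)) ?_
      push_cast
      field_simp
      ring
    rw [zwegersTerm_eq, zwegersTerm_eq, harg, hexp]
    ring
  have hTheta : ∀ j : ℤ, Theta j M (τ + 1) (2 * u) =
      e ((j : ℂ) ^ 2 / (4 * M)) * Theta j M τ (2 * u) := by
    intro j
    rw [Theta, Theta, ← tsum_mul_left]
    refine tsum_congr fun i => ?_
    rw [thetaTerm_eq hM, thetaTerm_eq hM, ← e_add]
    refine e_congr (j * i + M * i ^ 2) ?_
    push_cast
    field_simp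
    ring
  rw [appellMod, appellMod, happ, appellCorr, appellCorr]
  congr 2
  refine Finset.sum_congr rfl fun j _ => ?_
  rw [hR, hTheta, e_neg]
  have := e_ne_zero ((((j : ℕ) : ℤ) : ℂ) ^ 2 / (4 * M))
  field_simp

/-! ### The modified Appell function under `τ ↦ -1/τ` -/

theorem exists_hasWirtingerAt_appellCorr {M : ℕ} (hM : M ≠ 0) {τ : ℂ} (hτ : 0 < τ.im) (u v : ℂ) :
    ∃ a, HasWirtingerAt (fun v => appellCorr M τ u v) a
      (1 / 2 * (dbarFactor M τ v * thetaKernel M τ u v)) v := by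
  choose a ha using fun j : ℕ => exists_hasWirtingerAt_zwegersR hM j hτ v
  have hconst : ∀ c : ℂ, HasWirtingerAt (fun _ => c) 0 0 v :=
    fun c => (hasDerivAt_const v c).hasWirtingerAt
  have hsum := (hconst (1 / 2)).mul (HasWirtingerAt.sum (s := Finset.range (2 * M))
    fun j _ => (ha j).mul (hconst (Theta j M τ (2 * u))))
  simp only [mul_zero, zero_mul, zero_add, add_zero] at hsum
  have hb : 1 / 2 * (dbarFactor M τ v * thetaKernel M τ u v) =
      1 / 2 * ∑ j ∈ Finset.range (2 * M),
        dbarFactor M τ v * conj (Theta j M τ (2 * v)) * Theta j M τ (2 * u) := by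
    rw [thetaKernel, Finset.mul_sum]
    simp only [mul_assoc]
  rw [hb]
  exact ⟨_, hsum⟩

theorem exists_hasWirtingerAt_appellMod {M : ℕ} (hM : M ≠ 0) {τ : ℂ} (hτ : 0 < τ.im) {u v : ℂ}
    (h : OffLattice τ (u - v)) :
    ∃ a, HasWirtingerAt (fun v => appellMod M τ u v) a
      (-(1 / 2 * (dbarFactor M τ v * thetaKernel M τ u v))) v := by
  obtain ⟨a, ha⟩ := exists_hasWirtingerAt_appellCorr hM hτ u v
  have := (differentiableAt_appell hM hτ h).hasDerivAt.hasWirtingerAt.sub ha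
  rw [zero_sub] at this
  exact ⟨_, this⟩

theorem tendsto_mul_appellMod {M : ℕ} (hM : M ≠ 0) {τ : ℂ} (hτ : 0 < τ.im) (u : ℂ) :
    Tendsto (fun v => (v - u) * appellMod M τ u v) (𝓝[≠] u) (𝓝 (2 * π * I)⁻¹) := by
  obtain ⟨a, ha⟩ := exists_hasWirtingerAt_appellCorr hM hτ u u
  have h1 : Tendsto (fun v => (v - u) * appellCorr M τ u v) (𝓝[≠] u)
      (𝓝 ((u - u) * appellCorr M τ u u)) :=
    (((continuousAt_id.sub continuousAt_const).mul
      (HasFDerivAt.continuousAt ha)).tendsto).mono_left nhdsWithin_le_nhds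
  have h2 := (tendsto_mul_appell hM hτ u).sub h1
  rw [sub_self, zero_mul, sub_zero] at h2
  exact h2.congr fun v => by rw [appellMod]; ring

theorem ne_zero_of_im_pos {τ : ℂ} (hτ : 0 < τ.im) : τ ≠ 0 := by
  rintro rfl
  simp at hτ

theorem im_neg_one_div (τ : ℂ) : (-1 / τ).im = τ.im / ‖τ‖ ^ 2 := by
  rw [neg_div, one_div, Complex.neg_im, Complex.inv_im, Complex.normSq_eq_norm_sq]
  ring

theorem im_neg_one_div_pos {τ : ℂ} (hτ : 0 < τ.im) : 0 < (-1 / τ).im := by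
  rw [im_neg_one_div]
  have := norm_pos_iff.mpr (ne_zero_of_im_pos hτ)
  positivity

theorem OffLattice.neg_one_div {τ w : ℂ} (hτ : 0 < τ.im) (h : OffLattice τ w) :
    OffLattice (-1 / τ) (w / τ) := by
  intro j k hjk
  have hτ0 := ne_zero_of_im_pos hτ
  refine h (-k) j ?_
  field_simp at hjk
  rw [hjk]
  push_cast
  ring

theorem zwegersSlope_neg_one_div (M : ℕ) {τ : ℂ} (hτ : 0 < τ.im) :
    zwegersSlope M (-1 / τ) = ‖τ‖ * zwegersSlope M τ := by
  have hn := norm_pos_iff.mpr (ne_zero_of_im_pos hτ)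
  have hs : Real.sqrt (τ.im / ‖τ‖ ^ 2 / M) = Real.sqrt (τ.im / M) / ‖τ‖ := by
    rw [div_right_comm, Real.sqrt_div' _ (by positivity), Real.sqrt_sq hn.le]
  rw [zwegersSlope, zwegersSlope, im_neg_one_div, hs]
  field_simp

theorem im_sq_neg_one_div {τ : ℂ} (hτ : 0 < τ.im) (v : ℂ) :
    (v / τ).im ^ 2 / (-1 / τ).im + (v ^ 2 / τ).im = v.im ^ 2 / τ.im := by
  have hn : 0 < τ.re * τ.re + τ.im * τ.im := by
    nlinarith [mul_pos hτ hτ, mul_self_nonneg τ.re]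
  have h1 : (v / τ).im = (v.im * τ.re - v.re * τ.im) / (τ.re * τ.re + τ.im * τ.im) := by
    rw [Complex.div_im, Complex.normSq_apply]
    ring
  have h2 : (v ^ 2 / τ).im = (2 * v.re * v.im * τ.re - (v.re ^ 2 - v.im ^ 2) * τ.im) /
      (τ.re * τ.re + τ.im * τ.im) := by
    rw [Complex.div_im, Complex.normSq_apply, sq v, Complex.mul_re, Complex.mul_im]
    ring
  have h3 : (-1 / τ).im = τ.im / (τ.re * τ.re + τ.im * τ.im) := by
    rw [im_neg_one_div, ← Complex.normSq_eq_norm_sq, Complex.normSq_apply]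
  rw [h1, h2, h3]
  field_simp
  ring

/-- The Gaussian in Im v is not invariant under inversion; `im_sq_neg_one_div` shows that its defect
is exactly |e^{2πiMv²/τ}|². -/
theorem dbarFactor_neg_one_div (M : ℕ) {τ : ℂ} (hτ : 0 < τ.im) (v : ℂ) :
    dbarFactor M (-1 / τ) (v / τ) * (conj (e (M * v ^ 2 / τ)) * e (M * v ^ 2 / τ)) =
      ‖τ‖ * dbarFactor M τ v := by
  have him : (M * v ^ 2 / τ : ℂ).im = M * (v ^ 2 / τ).im := by
    have : (M * v ^ 2 / τ : ℂ) = ((M : ℝ) : ℂ) * (v ^ 2 / τ) := by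
      rw [mul_div_assoc]
      norm_cast
    rw [this, Complex.im_ofReal_mul]
  have hnorm : conj (e (M * v ^ 2 / τ)) * e (M * v ^ 2 / τ) =
      (Real.exp (-4 * π * (M * (v ^ 2 / τ).im)) : ℝ) := by
    rw [mul_comm, Complex.mul_conj, Complex.normSq_eq_norm_sq, norm_e, him, ← Real.exp_nat_mul]
    congr 2
    push_cast
    ring
  have hexp : Real.exp (-4 * π * M * (v / τ).im ^ 2 / (-1 / τ).im) *
      Real.exp (-4 * π * (M * (v ^ 2 / τ).im)) = Real.exp (-4 * π * M * v.im ^ 2 / τ.im) := by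
    rw [← Real.exp_add]
    congr 1
    linear_combination (-4 * π * M) * im_sq_neg_one_div hτ v
  rw [hnorm, dbarFactor, dbarFactor, zwegersSlope_neg_one_div M hτ, ← hexp]
  push_cast
  ring

/-- The defect of the modified Appell function under `τ ↦ -1/τ`. -/
def inversionDefect (M : ℕ) (τ u v : ℂ) : ℂ :=
  τ * appellMod M τ u v -
    e (-(M * (u ^ 2 - v ^ 2) / τ)) * appellMod M (-1 / τ) (u / τ) (v / τ)

/-- The v̄-derivatives of the two terms agree. One factor |τ| comes from `dbarFactor`, one from the
kernel, and the chain rule gives conj τ⁻¹; together |τ|² conj τ⁻¹ = τ. -/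
theorem differentiableAt_inversionDefect {M : ℕ} (hM : M ≠ 0) {τ : ℂ} (hτ : 0 < τ.im) {u v : ℂ}
    (h : OffLattice τ (u - v)) : DifferentiableAt ℂ (inversionDefect M τ u) v := by
  have hτ0 := ne_zero_of_im_pos hτ
  have h' : OffLattice (-1 / τ) (u / τ - τ⁻¹ * v) := by
    convert h.neg_one_div hτ using 1
    field_simp
  obtain ⟨a, ha⟩ := exists_hasWirtingerAt_appellMod hM hτ h
  obtain ⟨b, hb⟩ := exists_hasWirtingerAt_appellMod hM (im_neg_one_div_pos hτ) h'
  have hdiff : DifferentiableAt ℂ (fun v => e (-(M * (u ^ 2 - v ^ 2) / τ))) v :=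
    (differentiable_e _).comp v (f := fun v : ℂ => -(M * (u ^ 2 - v ^ 2) / τ)) (by fun_prop)
  have key := ((hasDerivAt_const v τ).hasWirtingerAt.mul ha).sub
    (hdiff.hasDerivAt.hasWirtingerAt.mul hb.comp_const_mul)
  have hfun : inversionDefect M τ u = fun x => τ * appellMod M τ u x -
      e (-(M * (u ^ 2 - x ^ 2) / τ)) * appellMod M (-1 / τ) (u / τ) (τ⁻¹ * x) := by
    funext x
    rw [inversionDefect, div_eq_inv_mul x τ]
  rw [hfun]
  have hbar : τ * -(1 / 2 * (dbarFactor M τ v * thetaKernel M τ u v)) +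
      0 * appellMod M τ u v - (e (-(M * (u ^ 2 - v ^ 2) / τ)) *
        (-(1 / 2 * (dbarFactor M (-1 / τ) (τ⁻¹ * v) *
          thetaKernel M (-1 / τ) (u / τ) (τ⁻¹ * v))) * conj τ⁻¹) +
        0 * appellMod M (-1 / τ) (u / τ) (τ⁻¹ * v)) = 0 := by
    have h1 : e (-(M * (u ^ 2 - v ^ 2) / τ)) * e (M * u ^ 2 / τ) = e (M * v ^ 2 / τ) := by
      rw [← e_add]
      congr 1
      ring
    have h2 := dbarFactor_neg_one_div M hτ v
    have h3 : (‖τ‖ : ℂ) * ‖τ‖ * conj τ⁻¹ = τ := by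
      rw [map_inv₀, ← sq, ← Complex.mul_conj']
      have : conj τ ≠ 0 := (map_ne_zero _).mpr hτ0
      field_simp
    rw [← div_eq_inv_mul v τ, thetaKernel_neg_one_div hM hτ]
    linear_combination (1 / 2 * dbarFactor M (-1 / τ) (v / τ) * ‖τ‖ * conj (e (M * v ^ 2 / τ)) *
      thetaKernel M τ u v * conj τ⁻¹) * h1 +
      (1 / 2 * ‖τ‖ * thetaKernel M τ u v * conj τ⁻¹) * h2 +
      (1 / 2 * dbarFactor M τ v * thetaKernel M τ u v) * h3
  rw [hbar] at key
  exact key.differentiableAt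

theorem isHalfIntegralPair_int (a b : ℤ) : IsHalfIntegralPair a b :=
  ⟨⟨2 * a, by push_cast; ring⟩, ⟨2 * b, by push_cast; ring⟩, ⟨a + b, by push_cast; ring⟩⟩

/-- Inversion exchanges the periods: v ↦ v + 1 subtracts the period -1/τ from v/τ, and the resulting
multiplier is absorbed by the exponential prefactor. -/
theorem inversionDefect_add_one {M : ℕ} (hM : M ≠ 0) {τ : ℂ} (hτ : 0 < τ.im) {u v : ℂ}
    (h : OffLattice τ (u - v)) : inversionDefect M τ u (v + 1) = inversionDefect M τ u v := by
  have hτ0 := ne_zero_of_im_pos hτ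
  have h' : OffLattice (-1 / τ) (u / τ - v / τ) := by
    rw [← sub_div]
    exact h.neg_one_div hτ
  have h1 := appellMod_add_real hM τ u v (isHalfIntegralPair_int 0 1)
  have h2 := appellMod_add_mul_tau hM (im_neg_one_div_pos hτ) h' (isHalfIntegralPair_int 0 (-1))
  simp only [Int.cast_zero, Int.cast_one, Int.cast_neg, Complex.ofReal_zero, Complex.ofReal_one,
    Complex.ofReal_neg, add_zero, zero_mul] at h1 h2
  have hv : (v + 1) / τ = v / τ + -1 * (-1 / τ) := by ring
  rw [inversionDefect, inversionDefect, h1, hv, h2, ← mul_assoc, ← e_add]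
  congr 3
  field_simp
  ring

theorem inversionDefect_add_tau {M : ℕ} (hM : M ≠ 0) {τ : ℂ} (hτ : 0 < τ.im) {u v : ℂ}
    (h : OffLattice τ (u - v)) :
    inversionDefect M τ u (v + τ) = e (M * (2 * v + τ)) * inversionDefect M τ u v := by
  have hτ0 := ne_zero_of_im_pos hτ
  have h1 := appellMod_add_mul_tau hM hτ h (isHalfIntegralPair_int 0 1)
  have h2 := appellMod_add_real hM (-1 / τ) (u / τ) (v / τ) (isHalfIntegralPair_int 0 1)
  simp only [Int.cast_zero, Int.cast_one, Complex.ofReal_zero, Complex.ofReal_one,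
    add_zero, zero_mul, one_mul] at h1 h2
  have hv : (v + τ) / τ = v / τ + 1 := by field_simp
  have he : e (-(M * (u ^ 2 - (v + τ) ^ 2) / τ)) =
      e (M * (2 * v + τ)) * e (-(M * (u ^ 2 - v ^ 2) / τ)) := by
    rw [← e_add]
    congr 1
    field_simp
    ring
  have he' : e (M * ((1 ^ 2 - 0 ^ 2) * τ + 2 * (-0 * u + v))) = e (M * (2 * v + τ)) := by
    congr 1
    ring
  rw [he'] at h1
  rw [inversionDefect, inversionDefect, h1, hv, h2, he]
  ring

/-- Both terms have residue τ/(2πi): the second because v - u = τ(v/τ - u/τ) and its exponential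
factor is 1 at v = u. -/
theorem tendsto_mul_inversionDefect {M : ℕ} (hM : M ≠ 0) {τ : ℂ} (hτ : 0 < τ.im) (u : ℂ) :
    Tendsto (fun v => (v - u) * inversionDefect M τ u v) (𝓝[≠] u) (𝓝 0) := by
  have hτ0 := ne_zero_of_im_pos hτ
  have h1 := (tendsto_mul_appellMod hM hτ u).const_mul τ
  have hdiv : Tendsto (fun v : ℂ => v / τ) (𝓝[≠] u) (𝓝[≠] (u / τ)) := by
    refine tendsto_nhdsWithin_iff.mpr ⟨?_, ?_⟩
    · have : Continuous fun v : ℂ => v / τ := by fun_prop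
      exact (this.tendsto u).mono_left nhdsWithin_le_nhds
    · filter_upwards [self_mem_nhdsWithin] with v hv h
      exact hv ((div_left_inj' hτ0).mp h)
  have h2 := ((tendsto_mul_appellMod hM (im_neg_one_div_pos hτ) (u / τ)).comp hdiv).const_mul τ
  have h3 : Tendsto (fun v => e (-(M * (u ^ 2 - v ^ 2) / τ))) (𝓝[≠] u) (𝓝 1) := by
    have : Continuous fun v => e (-(M * (u ^ 2 - v ^ 2) / τ)) :=
      continuous_e.comp (by fun_prop)
    have := (this.tendsto u).mono_left (nhdsWithin_le_nhds (s := {u}ᶜ))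
    simpa [e_zero] using this
  have h4 := h1.sub (h3.mul h2)
  rw [one_mul, sub_self] at h4
  refine h4.congr fun v => ?_
  rw [inversionDefect]
  simp only [Function.comp_apply]
  field_simp

theorem appellMod_neg_one_div {M : ℕ} (hM : M ≠ 0) {τ : ℂ} (hτ : 0 < τ.im) {u v : ℂ}
    (h : OffLattice τ (u - v)) :
    appellMod M (-1 / τ) (u / τ) (v / τ) =
      τ * e (M * (u ^ 2 - v ^ 2) / τ) * appellMod M τ u v := by
  have hD : inversionDefect M τ u v = 0 :=
    eq_zero_of_negative_index hM hτ (fun _ hv => differentiableAt_inversionDefect hM hτ hv)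
      (tendsto_mul_inversionDefect hM hτ u) (fun _ hv => inversionDefect_add_one hM hτ hv)
      (fun _ hv => inversionDefect_add_tau hM hτ hv) h
  rw [inversionDefect, sub_eq_zero, e_neg] at hD
  have := e_ne_zero (M * (u ^ 2 - v ^ 2) / τ)
  rw [mul_right_comm, hD]
  field_simp

/-! ### The modified numerators -/

theorem numeratorTerm_eq (m : ℕ) (τ u v : ℂ) (j : ℤ) :
    numeratorTerm m τ (v - u) (-u - v) j =
      appellCoeff (m + 1) τ (-u) j / (1 - e (-u - -v + j * τ)) -
        appellCoeff (m + 1) τ u j / (1 - e (u - -v + j * τ)) := by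
  simp only [numeratorTerm, qPow_eq_e, appellCoeff, ← e_add]
  congr 2
  · congr 1
    push_cast
    ring
  · congr 2
    ring
  · congr 1
    push_cast
    ring
  · congr 2
    ring

theorem summable_numeratorTerm (m : ℕ) {τ : ℂ} (hτ : 0 < τ.im) {z₁ z₂ : ℂ}
    (h : IsRegular τ z₁ z₂) : Summable (numeratorTerm m τ z₁ z₂) := by
  have h1 : OffLattice τ (-(-(z₁ + z₂) / 2) - -((z₁ - z₂) / 2)) := by
    intro j k hjk
    exact (h j k).1 (by rw [← hjk]; ring)
  have h2 : OffLattice τ (-(z₁ + z₂) / 2 - -((z₁ - z₂) / 2)) := by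
    intro j k hjk
    refine (h (-j) (-k)).2 ?_
    push_cast
    linear_combination -hjk
  have hs := (summable_appell (M := m + 1) (by omega) hτ h1).sub
    (summable_appell (M := m + 1) (by omega) hτ h2)
  refine hs.congr fun j => ?_
  rw [← numeratorTerm_eq]
  congr 1 <;> ring

theorem IsRegular.offLattice_sub {τ u v : ℂ} (h : IsRegular τ (v - u) (-u - v)) :
    OffLattice τ (u - v) := by
  have : OffLattice τ (v - u) := fun j k => (h j k).1
  simpa using this.neg

theorem IsRegular.offLattice_neg_sub {τ u v : ℂ} (h : IsRegular τ (v - u) (-u - v)) :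
    OffLattice τ (-u - v) := fun j k => (h j k).2

/-- The numerator is naturally A(-u, -v) - A(u, -v), whereas the correction contains R at v.
Reflecting both terms brings in Θ_{0,M}(±2u), which are equal and cancel, leaving A(-u, v) - A(u,
v). -/
theorem phiTilde_eq (m : ℕ) {τ : ℂ} (hτ : 0 < τ.im) {u v : ℂ} (h : IsRegular τ (v - u) (-u - v))
    (t : ℂ) : phiTilde m τ u v t =
      e ((m + 1) * t) * (appellMod (m + 1) τ (-u) v - appellMod (m + 1) τ u v) := by
  have hM : m + 1 ≠ 0 := by omega
  have h1 : OffLattice τ (-u - -v) := by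
    convert h.offLattice_sub.neg using 1
    ring
  have h2 : OffLattice τ (u - -v) := by
    convert h.offLattice_neg_sub.neg using 1
    ring
  have hsum : ∑' j : ℤ, numeratorTerm m τ (v - u) (-u - v) j =
      appell (m + 1) τ (-u) v - appell (m + 1) τ u v := by
    have h3 := appell_neg_neg hM hτ h.offLattice_sub
    have h4 := appell_neg_neg hM hτ h.offLattice_neg_sub
    have h5 : Theta 0 (m + 1) τ (2 * -u) = Theta 0 (m + 1) τ (2 * u) := by
      rw [mul_neg, ← Theta_neg_index hM, neg_zero]
    rw [neg_neg, h5] at h4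
    simp only [numeratorTerm_eq]
    rw [Summable.tsum_sub (summable_appell hM hτ h1) (summable_appell hM hτ h2), ← appell, ← appell,
      h3, h4]
    ring
  have hadd : phiAdd m τ u v t =
      e ((m + 1) * t) * (appellCorr (m + 1) τ u v - appellCorr (m + 1) τ (-u) v) := by
    rw [phiAdd, appellCorr, appellCorr, ← mul_sub, ← Finset.sum_sub_distrib]
    have hr : 2 * m + 2 = 2 * (m + 1) := by ring
    rw [hr, mul_comm (1 / 2 : ℂ), mul_assoc]
    congr 2
    refine Finset.sum_congr rfl fun j _ => ?_
    rw [Theta_neg_index hM, mul_sub, mul_neg]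
  rw [phiTilde, phi, Phi, hsum, hadd, appellMod, appellMod]
  ring

theorem PhiTilde_eq_phiTilde (m : ℕ) (τ z₁ z₂ t : ℂ) :
    PhiTilde m τ z₁ z₂ t = phiTilde m τ (-(z₁ + z₂) / 2) ((z₁ - z₂) / 2) t := by
  have hM : m + 1 ≠ 0 := by omega
  have h1 : (z₁ - z₂) / 2 - -(z₁ + z₂) / 2 = z₁ := by ring
  have h2 : -(-(z₁ + z₂) / 2) - (z₁ - z₂) / 2 = z₂ := by ring
  have h3 : 2 * (-(z₁ + z₂) / 2) = -(z₁ + z₂) := by ring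
  rw [PhiTilde, phiTilde, phi, h1, h2, PhiAdd, phiAdd, h3, neg_mul, neg_mul, ← mul_neg,
    ← Finset.sum_neg_distrib]
  congr 2
  refine Finset.sum_congr rfl fun j _ => ?_
  rw [Theta_neg_index hM, Theta_neg_index hM, neg_neg]
  ring

theorem IsHalfIntegralPair.neg_left {a b : ℝ} (h : IsHalfIntegralPair a b) :
    IsHalfIntegralPair (-a) b := by
  obtain ⟨⟨k, hk⟩, ⟨l, hl⟩, ⟨n, hn⟩⟩ := h
  refine ⟨⟨-k, by rw [hk]; push_cast; ring⟩, ⟨l, hl⟩, ⟨l - n, ?_⟩⟩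
  push_cast
  linarith

theorem IsRegular.add {τ u v : ℂ} (h : IsRegular τ (v - u) (-u - v)) {x y : ℂ}
    (h₁ : ∃ j k : ℤ, y - x = j + k * τ) (h₂ : ∃ j k : ℤ, -x - y = j + k * τ) :
    IsRegular τ (v + y - (u + x)) (-(u + x) - (v + y)) := by
  obtain ⟨a, b, hab⟩ := h₁
  obtain ⟨c, d, hcd⟩ := h₂
  intro j k
  constructor
  · intro hjk
    refine (h (j - a) (k - b)).1 ?_
    push_cast
    linear_combination hjk - hab
  · intro hjk
    refine (h (j - c) (k - d)).2 ?_
    push_cast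
    linear_combination hjk - hcd

theorem IsHalfIntegralPair.exists_int {a b : ℝ} (h : IsHalfIntegralPair a b) :
    (∃ j : ℤ, (b : ℂ) - a = j) ∧ ∃ j : ℤ, -(a : ℂ) - b = j := by
  obtain ⟨⟨k, hk⟩, ⟨l, hl⟩, ⟨n, hn⟩⟩ := h
  refine ⟨⟨l - n, ?_⟩, ⟨-n, ?_⟩⟩
  · have : b - a = l - n := by linarith
    exact_mod_cast congrArg (fun x : ℝ => (x : ℂ)) this
  · have : -a - b = -n := by linarith
    exact_mod_cast congrArg (fun x : ℝ => (x : ℂ)) this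

theorem phiTilde_neg_one_div (m : ℕ) {τ : ℂ} (hτ : 0 < τ.im) {u v : ℂ}
    (h : IsRegular τ (v - u) (-u - v)) (t : ℂ) :
    phiTilde m (-1 / τ) (u / τ) (v / τ) (t - (u ^ 2 - v ^ 2) / τ) = τ * phiTilde m τ u v t := by
  have hM : m + 1 ≠ 0 := by omega
  have h1 := h.offLattice_sub.neg.neg_one_div hτ
  have h2 := h.offLattice_neg_sub.neg_one_div hτ
  have hreg : IsRegular (-1 / τ) (v / τ - u / τ) (-(u / τ) - v / τ) := by
    intro j k
    constructor
    · convert h1 j k using 2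
      ring
    · convert h2 j k using 2
      ring
  rw [phiTilde_eq m (im_neg_one_div_pos hτ) hreg, phiTilde_eq m hτ h, ← neg_div,
    appellMod_neg_one_div hM hτ h.offLattice_sub, appellMod_neg_one_div hM hτ h.offLattice_neg_sub,
    neg_sq]
  -- The shift of t cancels the factor e^{2πiM(u² - v²)/τ}, common to Ã(-u, v) and Ã(u, v) because
  -- it is even in u.
  have he : e ((m + 1) * t) = e ((m + 1) * (t - (u ^ 2 - v ^ 2) / τ)) *
      e ((m + 1 : ℕ) * (u ^ 2 - v ^ 2) / τ) := by
    rw [← e_add]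
    congr 1
    push_cast
    ring
  rw [he]
  ring

theorem phiTilde_add_real (m : ℕ) {τ : ℂ} (hτ : 0 < τ.im) {u v : ℂ}
    (h : IsRegular τ (v - u) (-u - v)) (t : ℂ) {a b : ℝ} (hab : IsHalfIntegralPair a b) :
    phiTilde m τ (u + a) (v + b) t = phiTilde m τ u v t := by
  have hM : m + 1 ≠ 0 := by omega
  obtain ⟨⟨j, hj⟩, ⟨k, hk⟩⟩ := hab.exists_int
  have hreg := h.add (x := a) (y := b) ⟨j, 0, by rw [hj]; simp⟩ ⟨k, 0, by rw [hk]; simp⟩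
  have h1 := appellMod_add_real hM τ (-u) v hab.neg_left
  rw [Complex.ofReal_neg, ← neg_add] at h1
  rw [phiTilde_eq m hτ hreg, phiTilde_eq m hτ h, h1, appellMod_add_real hM τ u v hab]

theorem phiTilde_neg_right (m : ℕ) {τ : ℂ} (hτ : 0 < τ.im) {u v : ℂ}
    (h : IsRegular τ (v - u) (-u - v)) (t : ℂ) :
    phiTilde m τ u (-v) t = phiTilde m τ u v t := by
  have hM : m + 1 ≠ 0 := by omega
  have hreg : IsRegular τ (-v - u) (-u - -v) := by
    intro j k
    obtain ⟨h1, h2⟩ := h j k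
    exact ⟨fun h' => h2 (by rw [← h']; ring), fun h' => h1 (by rw [← h']; ring)⟩
  have h1 := appellMod_neg_neg hM hτ h.offLattice_neg_sub
  rw [neg_neg] at h1
  rw [phiTilde_eq m hτ hreg, phiTilde_eq m hτ h, appellMod_neg_neg hM hτ h.offLattice_sub, h1]
  ring

theorem phiTilde_neg_left (m : ℕ) {τ : ℂ} (hτ : 0 < τ.im) {u v : ℂ}
    (h : IsRegular τ (v - u) (-u - v)) (t : ℂ) :
    phiTilde m τ (-u) v t = -phiTilde m τ u v t := by
  have hreg : IsRegular τ (v - -u) (- -u - v) := by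
    intro j k
    refine ⟨fun h' => h.offLattice_neg_sub.neg j k ?_, fun h' => h.offLattice_sub j k ?_⟩
    · rw [← h']
      ring
    · rw [← h']
      ring
  rw [phiTilde_eq m hτ hreg, phiTilde_eq m hτ h, neg_neg]
  ring

theorem phiTilde_tau_add_one (m : ℕ) {τ : ℂ} (hτ : 0 < τ.im) {u v : ℂ}
    (h : IsRegular τ (v - u) (-u - v)) (t : ℂ) :
    phiTilde m (τ + 1) u v t = phiTilde m τ u v t := by
  have hM : m + 1 ≠ 0 := by omega
  have hreg : IsRegular (τ + 1) (v - u) (-u - v) := by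
    intro j k
    obtain ⟨h1, h2⟩ := h (j + k) k
    exact ⟨fun h' => h1 (by rw [h']; push_cast; ring), fun h' => h2 (by rw [h']; push_cast; ring)⟩
  rw [phiTilde_eq m (by simpa using hτ) hreg, phiTilde_eq m hτ h, appellMod_tau_add_one hM,
    appellMod_tau_add_one hM]

theorem phiTilde_add_mul_tau (m : ℕ) {τ : ℂ} (hτ : 0 < τ.im) {u v : ℂ}
    (h : IsRegular τ (v - u) (-u - v)) (t : ℂ) {a b : ℝ} (hab : IsHalfIntegralPair a b) :
    phiTilde m τ (u + a * τ) (v + b * τ) t =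
      qPow τ ((m + 1) * ((b : ℂ) ^ 2 - (a : ℂ) ^ 2)) *
        Complex.exp (4 * π * I * (m + 1) * (-a * u + b * v)) * phiTilde m τ u v t := by
  have hM : m + 1 ≠ 0 := by omega
  obtain ⟨⟨j, hj⟩, ⟨k, hk⟩⟩ := hab.exists_int
  have hreg := h.add (x := a * τ) (y := b * τ) ⟨0, j, by rw [← hj]; push_cast; ring⟩
    ⟨0, k, by rw [← hk]; push_cast; ring⟩
  have h1 := appellMod_add_mul_tau hM hτ h.offLattice_neg_sub hab.neg_left
  have hu : -(u + a * τ) = -u + (-a : ℝ) * τ := by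
    push_cast
    ring
  have he : Complex.exp (4 * π * I * (m + 1) * (-a * u + b * v)) =
      e ((m + 1) * (2 * (-a * u + b * v))) := by
    rw [e]
    congr 1
    ring
  have h2 : ((m + 1 : ℕ) : ℂ) * (((b : ℂ) ^ 2 - ((-a : ℝ) : ℂ) ^ 2) * τ +
      2 * (-((-a : ℝ) : ℂ) * -u + b * v)) =
      (m + 1 : ℕ) * (((b : ℂ) ^ 2 - (a : ℂ) ^ 2) * τ + 2 * (-a * u + b * v)) := by
    push_cast
    ring
  have h3 : ((m + 1 : ℕ) : ℂ) * (((b : ℂ) ^ 2 - (a : ℂ) ^ 2) * τ + 2 * (-a * u + b * v)) =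
      τ * ((m + 1) * ((b : ℂ) ^ 2 - (a : ℂ) ^ 2)) + (m + 1) * (2 * (-a * u + b * v)) := by
    push_cast
    ring
  rw [phiTilde_eq m hτ hreg, phiTilde_eq m hτ h, hu, h1, h2,
    appellMod_add_mul_tau hM hτ h.offLattice_sub hab, h3, e_add, he, qPow_eq_e]
  ring

end ModifiedNumerator

end

/-! ### The theorem and its corollary -/

open ModifiedNumerator in
theorem theorem5p9 (m : ℕ) :
    -- the series defining the functions converge
    (∀ τ : ℂ, 0 < τ.im →
      (∀ (j : ℤ) (z : ℂ), Summable (thetaTerm j (m + 1) τ z)) ∧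
      (∀ (j : ℤ) (v : ℂ), Summable fun n : {n : ℤ // n ≡ j [ZMOD 2 * (m + 1 : ℕ)]} =>
        zwegersTerm (m + 1) τ v n) ∧
      (∀ z₁ z₂ : ℂ, IsRegular τ z₁ z₂ → Summable (numeratorTerm m τ z₁ z₂))) ∧
    -- the coordinates `(u, v)`
    (∀ τ u v t : ℂ, 0 < τ.im → IsRegular τ (v - u) (-u - v) →
      phiTilde m (-1 / τ) (u / τ) (v / τ) (t - (u ^ 2 - v ^ 2) / τ) = τ * phiTilde m τ u v t ∧
      (∀ a b : ℝ, IsHalfIntegralPair a b →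
        phiTilde m τ (u + a) (v + b) t = phiTilde m τ u v t) ∧
      (phiTilde m τ u (-v) t = phiTilde m τ u v t ∧
        phiTilde m τ (-u) v t = -phiTilde m τ u v t) ∧
      phiTilde m (τ + 1) u v t = phiTilde m τ u v t ∧
      (∀ a b : ℝ, IsHalfIntegralPair a b →
        phiTilde m τ (u + a * τ) (v + b * τ) t =
          qPow τ ((m + 1) * ((b : ℂ) ^ 2 - (a : ℂ) ^ 2)) *
            Complex.exp (4 * Real.pi * Complex.I * (m + 1) * (-a * u + b * v)) *
            phiTilde m τ u v t)) ∧
    -- the coordinates `(z₁, z₂)`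
    (∀ τ z₁ z₂ t : ℂ, 0 < τ.im → IsRegular τ z₁ z₂ →
      PhiTilde m τ z₁ z₂ t = phiTilde m τ (-(z₁ + z₂) / 2) ((z₁ - z₂) / 2) t ∧
      PhiTilde m (-1 / τ) (z₁ / τ) (z₂ / τ) (t - z₁ * z₂ / τ) = τ * PhiTilde m τ z₁ z₂ t ∧
      (∀ a b : ℤ, PhiTilde m τ (z₁ + a) (z₂ + b) t = PhiTilde m τ z₁ z₂ t) ∧
      (PhiTilde m τ (-z₁) (-z₂) t = -PhiTilde m τ z₁ z₂ t ∧
        PhiTilde m τ z₂ z₁ t = PhiTilde m τ z₁ z₂ t) ∧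
      PhiTilde m (τ + 1) z₁ z₂ t = PhiTilde m τ z₁ z₂ t ∧
      (∀ j k : ℤ, PhiTilde m τ (z₁ + j * τ) (z₂ + k * τ) t =
        qPow τ (-((m + 1) * j * k)) *
          Complex.exp (-(2 * Real.pi * Complex.I * (m + 1) * (k * z₁ + j * z₂))) *
          PhiTilde m τ z₁ z₂ t)) := by
  have hM : m + 1 ≠ 0 := by omega
  refine ⟨fun τ hτ => ⟨fun j z => summable_thetaTerm hM hτ j z,
    fun j v => (summable_zwegersTerm hM hτ v).subtype _,
    fun z₁ z₂ h => summable_numeratorTerm m hτ h⟩,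
    fun τ u v t hτ h => ⟨phiTilde_neg_one_div m hτ h t, fun a b hab => phiTilde_add_real m hτ h t hab,
      ⟨phiTilde_neg_right m hτ h t, phiTilde_neg_left m hτ h t⟩, phiTilde_tau_add_one m hτ h t,
      fun a b hab => phiTilde_add_mul_tau m hτ h t hab⟩, ?_⟩
  intro τ z₁ z₂ t hτ hz
  have h : IsRegular τ ((z₁ - z₂) / 2 - -(z₁ + z₂) / 2) (-(-(z₁ + z₂) / 2) - (z₁ - z₂) / 2) := by
    convert hz using 1 <;> ring
  -- Integral shifts (a, b) of (z₁, z₂) become these shifts of (u, v), whose sum is -b.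
  have hpair : ∀ a b : ℤ, IsHalfIntegralPair (-(a + b) / 2) ((a - b) / 2) := fun a b =>
    ⟨⟨-(a + b), by push_cast; ring⟩, ⟨a - b, by push_cast; ring⟩, ⟨-b, by push_cast; ring⟩⟩
  refine ⟨PhiTilde_eq_phiTilde m τ z₁ z₂ t, ?_, fun a b => ?_, ⟨?_, ?_⟩, ?_, fun j k => ?_⟩
  · rw [PhiTilde_eq_phiTilde, PhiTilde_eq_phiTilde, ← phiTilde_neg_one_div m hτ h]
    congr 1 <;> ring
  · rw [PhiTilde_eq_phiTilde, PhiTilde_eq_phiTilde, ← phiTilde_add_real m hτ h t (hpair a b)]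
    congr 1 <;> (push_cast; ring)
  -- Negating z₁ and z₂ negates both u and v. The intermediate point (u, -v) corresponds to (z₂,
  -- z₁), hence the swapped regularity.
  · have h' : IsRegular τ (-((z₁ - z₂) / 2) - -(z₁ + z₂) / 2)
        (-(-(z₁ + z₂) / 2) - -((z₁ - z₂) / 2)) := by
      have hswap : IsRegular τ z₂ z₁ := fun j k => (hz j k).symm
      convert hswap using 1 <;> ring
    rw [PhiTilde_eq_phiTilde, PhiTilde_eq_phiTilde, ← phiTilde_neg_right m hτ h,
      ← phiTilde_neg_left m hτ h']
    congr 1 <;> ring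
  · rw [PhiTilde_eq_phiTilde, PhiTilde_eq_phiTilde, ← phiTilde_neg_right m hτ h]
    congr 1 <;> ring
  · rw [PhiTilde_eq_phiTilde, PhiTilde_eq_phiTilde, phiTilde_tau_add_one m hτ h]
  · rw [PhiTilde_eq_phiTilde, PhiTilde_eq_phiTilde]
    have h1 := phiTilde_add_mul_tau m hτ h t (hpair j k)
    have h2 : -(z₁ + j * τ + (z₂ + k * τ)) / 2 =
        -(z₁ + z₂) / 2 + ((-(j + k) / 2 : ℝ) : ℂ) * τ := by
      push_cast
      ring
    have h3 : (z₁ + j * τ - (z₂ + k * τ)) / 2 = (z₁ - z₂) / 2 + (((j - k) / 2 : ℝ) : ℂ) * τ := by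
      push_cast
      ring
    rw [h2, h3, h1]
    congr 2
    · congr 1
      push_cast
      ring
    · congr 1
      push_cast
      ring
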